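/- Let $d,N\ge 1$ be integers, $\Lambda=(\mathbb Z/N\mathbb Z)^d$, with standard unit vectors $e_1,\dots,e_d$, and let $\mathcal B$ be the family of nearest-neighbour bonds $\{x,x+e_i\}$ ($x\in\Lambda$, $1\le i\le d$), indexed by the pairs $(x,i)$, each bond being given an arbitrary orientation. For an oriented bond $b=(x,y)$ put $\partial_b=\partial/\partial\eta_y-\partial/\partial\eta_x$, and let $\bar\nabla=(\partial_b)_{b\in\mathcal B}$. Let $V_1,V_2\in C^2(\mathbb R)$ with $V_1''\ge C_->0$ and $V_2$ convex, let $$H(\eta)=\sum_{x\in\Lambda}V_1(\eta_x)+\sum_{(x,y)\in\mathcal B}V_2(\eta_x+\eta_y),\qquad \eta\in\mathbb R^\Lambda,$$ and for $\rho\in\mathbb R$ let $\mu_{\rho,N}$ be the canonical Gibbs measure, i.e. the probability measure on the hyperplane $S_{\rho,N}=\{\eta\in\mathbb R^\Lambda:\sum_x\eta_x=|\Lambda|\rho\}$ with density proportional to $e^{-H}$ with respect to Lebesgue measure on $S_{\rho,N}$. Write $\langle\cdot\rangle$ for expectation under $\mu_{\rho,N}$ and $\langle f;g\rangle=\langle (f-\langle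 f\rangle)(g-\langle g\rangle)\rangle$. The generator of the conservative Ginzburg--Landau dynamics, its Dirichlet form and the associated Witten Laplacian, which acts on functions $U:S_{\rho,N}\to\mathbb R^{\mathcal B}$, are $$L=\sum_{b\in\mathcal B}\bigl(-\partial_b^2+(\partial_bH)\,\partial_b\bigr),\qquad \mathcal E(f,g)=\langle f\,Lg\rangle,\qquad (\mathcal L U)_b=L U_b+\sum_{c\in\mathcal B}(\partial_b\partial_cH)\,U_c .$$ Define $$\lambda=\inf_{f}\frac{\mathcal E(f,f)}{\langle f;f\rangle},\qquad \tilde\lambda=\inf_{f}\frac{\langle\bar\nabla f\cdot\mathcal L\bar\nabla f\rangle}{\langle\bar\nabla f\cdot\bar\nabla f\rangle},$$ the infima being over the $f\in C_c^\infty(S_{\rho,N},\mathbb R)$ with $\langle f\rangle=0$ for which the denominator is nonzero (with $\inf\emptyset=+\infty$, which occurs only for $N=1$). Then there is an absolute constant $k>0$ (not depending on $d$, $N$, $\rho$, $V_1$, $V_2$, $C_-$ or the orientation) such that $$\lambda\ \ge\ \tilde\lambda\ \ge\ \frac{k\,C_-}{N^2}.$$ -/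

import Mathlib

open MeasureTheory
open scoped ContDiff

noncomputable section

namespace GinzburgLandau

/-- The `d`-dimensional discrete torus `Λ = (ℤ/Nℤ)^d`. -/
abbrev Torus (d N : ℕ) : Type := Fin d → ZMod N

/-- Configurations `η ∈ ℝ^Λ`. -/
abbrev Config (d N : ℕ) : Type := EuclideanSpace ℝ (Torus d N)

/-- Nearest neighbour bonds of the torus: the pair `(x, i)` stands for the edge between
`x` and `x + e_i`. -/
abbrev Bond (d N : ℕ) : Type := Torus d N × Fin d

/-- A choice of orientation for every bond: `true` orients `(x, i)` from `x` to `x + e_i`,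
`false` from `x + e_i` to `x`. -/
abbrev Orientation (d N : ℕ) : Type := Bond d N → Bool

variable {d N : ℕ}

/-- The starting point of an oriented bond. -/
def tail (o : Orientation d N) (b : Bond d N) : Torus d N :=
  if o b then b.1 else b.1 + Pi.single b.2 1

/-- The end point of an oriented bond. -/
def head (o : Orientation d N) (b : Bond d N) : Torus d N :=
  if o b then b.1 + Pi.single b.2 1 else b.1

/-- The vector `e_y - e_x` attached to the oriented bond `b = (x, y)`. -/
def bondVec (o : Orientation d N) (b : Bond d N) : Config d N :=
  EuclideanSpace.single (head o b) (1 : ℝ) - EuclideanSpace.single (tail o b) (1 : ℝ)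

variable [NeZero N]

/-- The operator `∂_b = ∂/∂η_y - ∂/∂η_x` for the oriented bond `b = (x, y)`. -/
def bondDeriv (o : Orientation d N) (b : Bond d N) (f : Config d N → ℝ) : Config d N → ℝ :=
  fun η => fderiv ℝ f η (bondVec o b)

/-- The gradient `∇̄ f = (∂_b f)_b`. -/
def bondGrad (o : Orientation d N) (f : Config d N → ℝ) : Config d N → Bond d N → ℝ :=
  fun η b => bondDeriv o b f η

/-- The bond-wise Hessian matrix `[∂_b ∂_c H]`. -/
def bondHess (o : Orientation d N) (H : Config d N → ℝ) (η : Config d N) :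
    Matrix (Bond d N) (Bond d N) ℝ :=
  Matrix.of fun b c => bondDeriv o b (bondDeriv o c H) η

/-- The generator `L = -∇̄·∇̄ + ∇̄H·∇̄`. -/
def generator (o : Orientation d N) (H f : Config d N → ℝ) : Config d N → ℝ :=
  fun η => ∑ b : Bond d N,
    (-(bondDeriv o b (bondDeriv o b f) η) + bondDeriv o b H η * bondDeriv o b f η)

/-- The Witten Laplacian `𝓛 U = (L ⊗ Id) U + (Hess H) U`. -/
def wittenLaplacian (o : Orientation d N) (H : Config d N → ℝ)
    (U : Config d N → Bond d N → ℝ) : Config d N → Bond d N → ℝ :=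
  fun η b => generator o H (fun ζ => U ζ b) η + (bondHess o H η).mulVec (U η) b

/-- The Hamiltonian `H(η) = ∑_x V₁(η_x) + ∑_{(x,y)} V₂(η_x + η_y)`, the second sum being over
bonds (it does not depend on their orientation). -/
def hamiltonian (V₁ V₂ : ℝ → ℝ) : Config d N → ℝ :=
  fun η => (∑ x : Torus d N, V₁ (η x)) +
    ∑ b : Bond d N, V₂ (η b.1 + η (b.1 + Pi.single b.2 1))

variable (d N) in
/-- The linear subspace `{v ∈ ℝ^Λ : ∑_x v_x = 0}`. -/
def zeroSum : Submodule ℝ (Config d N) where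
  carrier := {v | ∑ x, v x = 0}
  add_mem' {v w} hv hw := by
    simp only [Set.mem_ofPred_eq] at hv hw
    simp [Finset.sum_add_distrib, hv, hw]
  zero_mem' := by simp
  smul_mem' c v hv := by
    simp only [Set.mem_ofPred_eq] at hv
    simp [← Finset.mul_sum, hv]

variable (d N) in
/-- The hyperplane `S_{ρ,N} = {η : ∑_x η_x = |Λ| ρ}`. -/
def hyperplane (ρ : ℝ) : Set (Config d N) :=
  {η | ∑ x, η x = (Fintype.card (Torus d N) : ℝ) * ρ}

variable (d N) in
/-- The parametrisation of `S_{ρ,N}` by zero-sum vectors, `v ↦ v + (ρ, …, ρ)`. -/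
def shift (ρ : ℝ) (v : zeroSum d N) : Config d N :=
  (v : Config d N) + WithLp.toLp 2 (fun _ => ρ)

theorem volume_zeroSum :
    (inferInstance : MeasureSpace (zeroSum d N)) = measureSpaceOfInnerProductSpace := rfl

theorem shift_range (ρ : ℝ) : Set.range (shift d N ρ) = hyperplane d N ρ := by
  ext η
  constructor
  · rintro ⟨v, rfl⟩
    have hv : ∑ x, (v : Config d N) x = 0 := v.2
    simp [shift, hyperplane, Finset.sum_add_distrib, hv]
  · intro hη
    have h : ∑ x, η x = (Fintype.card (Torus d N) : ℝ) * ρ := hη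
    refine ⟨⟨η - WithLp.toLp 2 (fun _ => ρ), ?_⟩, ?_⟩
    · change ∑ x, (η - WithLp.toLp 2 (fun _ => ρ) : Config d N) x = 0
      simp only [PiLp.sub_apply, Finset.sum_sub_distrib, h]
      simp
    · simp [shift]

variable (d N) in
/-- Lebesgue (surface) measure on the hyperplane `S_{ρ,N}`, as a measure on `ℝ^Λ`: the image of
the Lebesgue measure of the Euclidean space of zero-sum vectors (the `volume` of a
finite-dimensional inner product space). -/
def surfaceMeasure (ρ : ℝ) : Measure (Config d N) :=
  (volume : Measure (zeroSum d N)).map (shift d N ρ)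

/-- The measure `e^{-H}` times the surface measure of `S_{ρ,N}`. -/
def weightedMeasure (H : Config d N → ℝ) (ρ : ℝ) : Measure (Config d N) :=
  (surfaceMeasure d N ρ).withDensity (fun η => ENNReal.ofReal (Real.exp (-(H η))))

/-- The canonical Gibbs measure `μ_{ρ,N}`: the Gibbs measure `Z⁻¹ e^{-H(η)} dη` conditioned on
`∑_x η_x = |Λ| ρ`, that is, the probability measure on `S_{ρ,N}` whose density with respect to
the surface measure is proportional to `e^{-H}`. -/
def canonicalMeasure (H : Config d N → ℝ) (ρ : ℝ) : Measure (Config d N) :=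
  (weightedMeasure H ρ Set.univ)⁻¹ • weightedMeasure H ρ

/-- The expectation with respect to the canonical measure. -/
def expect (H : Config d N → ℝ) (ρ : ℝ) (f : Config d N → ℝ) : ℝ :=
  ∫ η, f η ∂(canonicalMeasure H ρ)

/-- The correlation `⟨f ; g⟩ = ⟨(f - ⟨f⟩)(g - ⟨g⟩)⟩`. -/
def correlation (H : Config d N → ℝ) (ρ : ℝ) (f g : Config d N → ℝ) : ℝ :=
  expect H ρ (fun η => (f η - expect H ρ f) * (g η - expect H ρ g))

/-- The Dirichlet form `ℰ(f, g) = ⟨f L g⟩`. -/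
def dirichletForm (o : Orientation d N) (H : Config d N → ℝ) (ρ : ℝ)
    (f g : Config d N → ℝ) : ℝ :=
  expect H ρ (fun η => f η * generator o H g η)

/-- The test functions `f ⊥ 1`: smooth, compactly supported, with `⟨f⟩ = 0`. The restrictions to
`S_{ρ,N}` of functions in `C_c^∞(ℝ^Λ)` are exactly the functions in `C_c^∞(S_{ρ,N})`; since the
`∂_b` are tangent to `S_{ρ,N}` and the canonical measure lives on it, only the restriction
matters. -/
structure IsCenteredTest (H : Config d N → ℝ) (ρ : ℝ) (f : Config d N → ℝ) : Prop where
  smooth : ContDiff ℝ ∞ f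
  compact : HasCompactSupport f
  centered : expect H ρ f = 0

/-- The spectral gap `λ = inf_{f ⊥ 1} ℰ(f, f) / ⟨f ; f⟩`, over `f` with nonzero denominator.
It is extended-real valued, so that the infimum over the empty set (one-point torus) is `+∞`. -/
def spectralGap (o : Orientation d N) (H : Config d N → ℝ) (ρ : ℝ) : EReal :=
  ⨅ (f : Config d N → ℝ) (_ : IsCenteredTest H ρ f) (_ : correlation H ρ f f ≠ 0),
    ((dirichletForm o H ρ f f / correlation H ρ f f : ℝ) : EReal)

/-- The gap of the Witten Laplacian on gradients,
`λ̃ = inf_{f ⊥ 1} ⟨∇̄f · 𝓛 ∇̄f⟩ / ⟨∇̄f · ∇̄f⟩`, over `f` with nonzero denominator. -/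
def wittenGap (o : Orientation d N) (H : Config d N → ℝ) (ρ : ℝ) : EReal :=
  ⨅ (f : Config d N → ℝ) (_ : IsCenteredTest H ρ f)
    (_ : expect H ρ (fun η => bondGrad o f η ⬝ᵥ bondGrad o f η) ≠ 0),
    ((expect H ρ (fun η => bondGrad o f η ⬝ᵥ wittenLaplacian o H (bondGrad o f) η) /
      expect H ρ (fun η => bondGrad o f η ⬝ᵥ bondGrad o f η) : ℝ) : EReal)

end GinzburgLandau

end

open MeasureTheory
open scoped ContDiff

set_option linter.unusedSectionVars false

/-! Both inequalities come from two readings of the quadratic form of the Witten Laplacian on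
gradients.

For the upper reading, the commutation relation `dirDeriv_driftLaplacian` gives `𝓛 ∇̄f = ∇̄(L f)`,
and the symmetry of `L` turns `⟨∇̄f · 𝓛 ∇̄f⟩` into `⟨(L f)²⟩` (`expect_wittenLaplacian`). So any `γ`
below the Witten gap satisfies `γ ⟨|∇̄u|²⟩ ≤ ⟨(L u)²⟩` for centred test functions `u`. If `f = L u`,
then `⟨f²⟩ = ⟨∇̄f · ∇̄u⟩`, and Cauchy-Schwarz yields the Poincaré inequality with constant `γ`. It
suffices that the functions `L u` be dense in the centred part of L²
(`exists_submodule_driftLaplacian`, `poincare_of_le_driftLaplacian_sq`).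

Density is a Liouville statement: a function `g` in L² orthogonal to every such `L u` is a weak
solution of `L g = c`, and must be constant. As `H` is only C², `g` is mollified as `γ = (κ * (g
e^{-H})) e^H`, which satisfies the equation up to a commutator that is small on compact sets. A
Caccioppoli estimate (`sum_integral_sq_le`) bounds the energy of `γ`. Testing with cutoffs of small
gradient forces `c = 0`; the estimate then makes the energy arbitrarily small, so the distributional
gradient of `g` vanishes (`const_eq_zero`, `integral_mul_dirDeriv_eq_zero`, `ae_eq_const`). The bond
vectors span the tangent space, hence `g` is constant.

For the lower reading, `⟨∇̄f · 𝓛 ∇̄f⟩` is a sum of nonnegative Dirichlet energies of the `∂_b f`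
plus the Hessian term. The latter is at least `C ∑ W_x²`, where `W` is the lattice Laplacian of `x ↦
∂f/∂η_x`; the `V₂` part is nonnegative by convexity. On the torus `∑ (Δg)²` equals the sum of
squares of all second differences, and a Poincaré inequality on each coordinate cycle gives `∑ |∇g|²
≤ N² ∑ (Δg)²` (`sum_diff_sq_le_sum_laplacian_sq`), uniformly in the dimension. Hence the bound with
`k = 1`. -/

namespace GinzburgLandau

/-! ### Directional derivatives, the drift Laplacian, its commutation relation and its symmetry. -/

section Calculus

variable {E : Type*} [NormedAddCommGroup E] [NormedSpace ℝ E]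
  {ι : Type*} [Fintype ι]

/-- The derivative of `f` in the direction `e`. -/
noncomputable def dirDeriv (e : E) (f : E → ℝ) : E → ℝ := fun x => fderiv ℝ f x e

/-- The operator `-∑ ∂_b² + ∑ (∂_b H) ∂_b` attached to a finite family of directions. -/
noncomputable def driftLaplacian (v : ι → E) (H f : E → ℝ) : E → ℝ :=
  fun x => ∑ b, (-(dirDeriv (v b) (dirDeriv (v b) f) x) + dirDeriv (v b) H x * dirDeriv (v b) f x)

theorem contDiff_dirDeriv {n m : WithTop ℕ∞} {f : E → ℝ} (hf : ContDiff ℝ n f) (hmn : m + 1 ≤ n)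
    (e : E) : ContDiff ℝ m (dirDeriv e f) :=
  (hf.fderiv_right hmn).clm_apply contDiff_const

theorem hasCompactSupport_dirDeriv {f : E → ℝ} (hf : HasCompactSupport f) (e : E) :
    HasCompactSupport (dirDeriv e f) :=
  hf.fderiv_apply (𝕜 := ℝ) e

theorem dirDeriv_add {f g : E → ℝ} (hf : Differentiable ℝ f) (hg : Differentiable ℝ g) (e : E) :
    dirDeriv e (fun x => f x + g x) = fun x => dirDeriv e f x + dirDeriv e g x := by
  funext x
  simp [dirDeriv, fderiv_fun_add (hf x) (hg x)]

theorem dirDeriv_const_mul {f : E → ℝ} (hf : Differentiable ℝ f) (a : ℝ) (e : E) :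
    dirDeriv e (fun x => a * f x) = fun x => a * dirDeriv e f x := by
  funext x
  simp [dirDeriv, fderiv_const_mul (hf x)]

theorem dirDeriv_mul {f g : E → ℝ} {x : E} (hf : DifferentiableAt ℝ f x)
    (hg : DifferentiableAt ℝ g x) (e : E) :
    dirDeriv e (fun y => f y * g y) x = f x * dirDeriv e g x + dirDeriv e f x * g x := by
  simp [dirDeriv, fderiv_fun_mul hf hg, mul_comm]

theorem dirDeriv_exp_neg {H : E → ℝ} {x : E} (hH : DifferentiableAt ℝ H x) (e : E) :
    dirDeriv e (fun y => Real.exp (-(H y))) x = -(Real.exp (-(H x)) * dirDeriv e H x) := by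
  have h : HasFDerivAt (fun y => Real.exp (-(H y))) (Real.exp (-(H x)) • -(fderiv ℝ H x)) x :=
    hH.hasFDerivAt.neg.exp
  simp [dirDeriv, h.fderiv]

theorem dirDeriv_sum {κ : Type*} (s : Finset κ) {f : κ → E → ℝ}
    (hf : ∀ i ∈ s, Differentiable ℝ (f i)) (e : E) :
    dirDeriv e (fun x => ∑ i ∈ s, f i x) = fun x => ∑ i ∈ s, dirDeriv e (f i) x := by
  funext x
  simp [dirDeriv, fderiv_fun_sum fun i hi => (hf i hi) x]

theorem dirDeriv_comm {f : E → ℝ} (hf : ContDiff ℝ 2 f) (e e' : E) :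
    dirDeriv e (dirDeriv e' f) = dirDeriv e' (dirDeriv e f) := by
  funext x
  have hd : DifferentiableAt ℝ (fderiv ℝ f) x :=
    ((hf.fderiv_right (m := 1) (by norm_num)).differentiable (by norm_num)) x
  have hs : IsSymmSndFDerivAt ℝ f x := hf.contDiffAt.isSymmSndFDerivAt (by simp)
  have key : ∀ a b : E, dirDeriv a (dirDeriv b f) x = fderiv ℝ (fderiv ℝ f) x a b := by
    intro a b
    have := (hd.hasFDerivAt.clm_apply (hasFDerivAt_const b x)).fderiv
    change fderiv ℝ (fun y => fderiv ℝ f y b) x a = _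
    rw [this]
    simp
  rw [key, key]
  exact hs e e'

theorem contDiff_driftLaplacian {n : WithTop ℕ∞} {v : ι → E} {H f : E → ℝ}
    (hH : ContDiff ℝ (n + 1) H) (hf : ContDiff ℝ (n + 2) f) :
    ContDiff ℝ n (driftLaplacian v H f) := by
  refine ContDiff.sum fun b _ => ((contDiff_dirDeriv (n := n + 1)
    (contDiff_dirDeriv hf ?_ _) le_rfl _).neg).add ((contDiff_dirDeriv hH le_rfl _).mul
    (contDiff_dirDeriv hf ?_ _))
  · rw [add_assoc]; norm_num
  · exact add_le_add_right one_le_two n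

theorem hasCompactSupport_driftLaplacian {v : ι → E} {H f : E → ℝ} (hf : HasCompactSupport f) :
    HasCompactSupport (driftLaplacian v H f) := by
  refine hf.mono' fun x hx => ?_
  by_contra hx'
  refine hx (Finset.sum_eq_zero fun b _ => ?_)
  have h1 : dirDeriv (v b) f x = 0 := by
    have : x ∉ tsupport (dirDeriv (v b) f) := fun h => hx' (tsupport_fderiv_apply_subset ℝ (v b) h)
    exact image_eq_zero_of_notMem_tsupport this
  have h2 : dirDeriv (v b) (dirDeriv (v b) f) x = 0 := by
    have : x ∉ tsupport (dirDeriv (v b) (dirDeriv (v b) f)) := fun h =>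
      hx' (tsupport_fderiv_apply_subset ℝ (v b) (tsupport_fderiv_apply_subset ℝ (v b) h))
    exact image_eq_zero_of_notMem_tsupport this
  simp [h1, h2]

theorem driftLaplacian_add {v : ι → E} {H f g : E → ℝ} (hf : ContDiff ℝ 2 f)
    (hg : ContDiff ℝ 2 g) :
    driftLaplacian v H (fun x => f x + g x) =
      fun x => driftLaplacian v H f x + driftLaplacian v H g x := by
  have h1 : (1 : WithTop ℕ∞) + 1 ≤ 2 := by norm_num
  funext x
  simp only [driftLaplacian, ← Finset.sum_add_distrib]
  refine Finset.sum_congr rfl fun b _ => ?_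
  rw [dirDeriv_add (hf.differentiable (by norm_num)) (hg.differentiable (by norm_num)),
    dirDeriv_add ((contDiff_dirDeriv hf h1 _).differentiable (by norm_num))
      ((contDiff_dirDeriv hg h1 _).differentiable (by norm_num))]
  ring

theorem driftLaplacian_const_mul {v : ι → E} {H f : E → ℝ} (hf : ContDiff ℝ 2 f) (a : ℝ) :
    driftLaplacian v H (fun x => a * f x) = fun x => a * driftLaplacian v H f x := by
  have h1 : (1 : WithTop ℕ∞) + 1 ≤ 2 := by norm_num
  funext x
  simp only [driftLaplacian, Finset.mul_sum]
  refine Finset.sum_congr rfl fun b _ => ?_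
  rw [dirDeriv_const_mul (hf.differentiable (by norm_num)),
    dirDeriv_const_mul ((contDiff_dirDeriv hf h1 _).differentiable (by norm_num))]
  ring

/-- The commutation relation behind the Witten Laplacian: `∂_b L = L ∂_b + ∑_c (∂_b ∂_c H) ∂_c`. -/
theorem dirDeriv_driftLaplacian {v : ι → E} {H f : E → ℝ} (hH : ContDiff ℝ 2 H)
    (hf : ContDiff ℝ 3 f) (e : E) (x : E) :
    dirDeriv e (driftLaplacian v H f) x = driftLaplacian v H (dirDeriv e f) x +
      ∑ c, dirDeriv e (dirDeriv (v c) H) x * dirDeriv (v c) f x := by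
  have hf2 : ContDiff ℝ 2 f := hf.of_le (by norm_num)
  have d1 (a : E) : ContDiff ℝ 2 (dirDeriv a f) := contDiff_dirDeriv hf (by norm_num) a
  have d2 (a a' : E) : ContDiff ℝ 1 (dirDeriv a (dirDeriv a' f)) :=
    contDiff_dirDeriv (d1 a') (by norm_num) a
  have dH (a : E) : ContDiff ℝ 1 (dirDeriv a H) := contDiff_dirDeriv hH (by norm_num) a
  have e1 (a : E) : Differentiable ℝ (dirDeriv a f) := (d1 a).differentiable (by norm_num)
  have e2 (a a' : E) : Differentiable ℝ (dirDeriv a (dirDeriv a' f)) :=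
    (d2 a a').differentiable (by norm_num)
  have eH (a : E) : Differentiable ℝ (dirDeriv a H) := (dH a).differentiable (by norm_num)
  unfold driftLaplacian
  rw [dirDeriv_sum (f := fun b x => -dirDeriv (v b) (dirDeriv (v b) f) x +
    dirDeriv (v b) H x * dirDeriv (v b) f x) _
    fun c _ => (e2 _ _).neg.add ((eH _).mul (e1 _)), ← Finset.sum_add_distrib]
  refine Finset.sum_congr rfl fun c _ => ?_
  have hneg : (fun x => -dirDeriv (v c) (dirDeriv (v c) f) x) =
      fun x => (-1 : ℝ) * dirDeriv (v c) (dirDeriv (v c) f) x := by funext; ring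
  have s1 := dirDeriv_add (f := fun x => -dirDeriv (v c) (dirDeriv (v c) f) x)
    (g := fun x => dirDeriv (v c) H x * dirDeriv (v c) f x) (e2 _ _).neg ((eH _).mul (e1 _)) e
  rw [s1]
  dsimp only
  -- The third-order term needs two swaps, `∂_e ∂_c ∂_c f = ∂_c ∂_e ∂_c f = ∂_c ∂_c ∂_e f`; the
  -- Hessian term is what differentiating the drift coefficient leaves over.
  rw [hneg, dirDeriv_const_mul (e2 _ _), dirDeriv_mul (eH _ x) (e1 _ x),
    dirDeriv_comm (d1 _) e, dirDeriv_comm hf2 e]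
  ring

variable [FiniteDimensional ℝ E] [MeasurableSpace E] [BorelSpace E] (μ : Measure E)
  [μ.IsAddHaarMeasure]

theorem integral_dirDeriv_mul {f g : E → ℝ} (hf : ContDiff ℝ 1 f) (hg : ContDiff ℝ 1 g)
    (hc : HasCompactSupport g) (e : E) :
    ∫ x, dirDeriv e f x * g x ∂μ = -∫ x, f x * dirDeriv e g x ∂μ := by
  have cf : Continuous (dirDeriv e f) := (contDiff_dirDeriv (m := 0) hf (by norm_num) e).continuous
  have cg : Continuous (dirDeriv e g) := (contDiff_dirDeriv (m := 0) hg (by norm_num) e).continuous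
  have := integral_mul_fderiv_eq_neg_fderiv_mul_of_integrable (μ := μ) (f := f) (g := g) (v := e)
    ((cf.mul hg.continuous).integrable_of_hasCompactSupport hc.mul_left)
    ((hf.continuous.mul cg).integrable_of_hasCompactSupport
      (hasCompactSupport_dirDeriv hc e).mul_left)
    ((hf.continuous.mul hg.continuous).integrable_of_hasCompactSupport hc.mul_left)
    (fun x _ => hf.differentiable (by norm_num) x) (fun x _ => hg.differentiable (by norm_num) x)
  simp only [dirDeriv]
  rw [this, neg_neg]

/-- Symmetry of the drift Laplacian: `∫ h (L f) e^{-H} = ∑_b ∫ (∂_b f) (∂_b h) e^{-H}`. -/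
theorem integral_mul_driftLaplacian {v : ι → E} {H f h : E → ℝ} (hH : ContDiff ℝ 1 H)
    (hf : ContDiff ℝ 2 f) (hh : ContDiff ℝ 1 h) (hc : HasCompactSupport h) :
    ∫ x, h x * driftLaplacian v H f x * Real.exp (-(H x)) ∂μ =
      ∑ b, ∫ x, dirDeriv (v b) f x * dirDeriv (v b) h x * Real.exp (-(H x)) ∂μ := by
  have d1 (a : E) : ContDiff ℝ 1 (dirDeriv a f) := contDiff_dirDeriv hf (by norm_num) a
  have d2 (a : E) : ContDiff ℝ 0 (dirDeriv a (dirDeriv a f)) :=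
    contDiff_dirDeriv (d1 a) (by norm_num) a
  have dH (a : E) : ContDiff ℝ 0 (dirDeriv a H) := contDiff_dirDeriv hH (by norm_num) a
  have hw : ContDiff ℝ 1 (fun x => Real.exp (-(H x))) := hH.neg.exp
  have : ∀ x, h x * driftLaplacian v H f x * Real.exp (-(H x)) = ∑ b,
      h x * (-(dirDeriv (v b) (dirDeriv (v b) f) x) + dirDeriv (v b) H x * dirDeriv (v b) f x) *
        Real.exp (-(H x)) := by
    intro x
    rw [driftLaplacian, Finset.mul_sum, Finset.sum_mul]
  simp_rw [this]
  rw [integral_finsetSum]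
  · refine Finset.sum_congr rfl fun b _ => ?_
    have key := integral_dirDeriv_mul μ (f := fun x => Real.exp (-(H x)) * dirDeriv (v b) f x)
      (hw.mul (d1 _)) hh hc (v b)
    -- Divergence form: `(L f) e^{-H} = -∑_b ∂_b (e^{-H} ∂_b f)`, so one integration by parts per
    -- direction suffices.
    have e1 : ∀ x, h x * (-(dirDeriv (v b) (dirDeriv (v b) f) x) +
        dirDeriv (v b) H x * dirDeriv (v b) f x) * Real.exp (-(H x)) =
        -(dirDeriv (v b) (fun x => Real.exp (-(H x)) * dirDeriv (v b) f x) x * h x) := by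
      intro x
      rw [dirDeriv_mul (hw.differentiable (by norm_num) x)
        ((d1 _).differentiable (by norm_num) x),
        dirDeriv_exp_neg (hH.differentiable (by norm_num) x)]
      ring
    simp_rw [e1]
    rw [integral_neg, key, neg_neg]
    refine integral_congr_ae (ae_of_all _ fun x => ?_)
    ring
  · intro b _
    refine Continuous.integrable_of_hasCompactSupport ?_ ?_
    · exact (hh.continuous.mul ((d2 _).continuous.neg.add
        ((dH _).continuous.mul (d1 _).continuous))).mul hw.continuous
    · exact (hc.mul_right).mul_right

end Calculus

/-! ### Convolution with a compactly supported kernel. -/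

section Smear

open scoped Convolution

variable {E : Type*} [NormedAddCommGroup E] [NormedSpace ℝ E] [FiniteDimensional ℝ E]
  [MeasurableSpace E] [BorelSpace E] (μ : Measure E) [μ.IsAddHaarMeasure]
  {κ f : E → ℝ}

/-- The convolution of `f` with the kernel `κ`. -/
noncomputable def smear (κ f : E → ℝ) : E → ℝ := κ ⋆[ContinuousLinearMap.lsmul ℝ ℝ, μ] f

theorem smear_apply (κ f : E → ℝ) (x : E) : smear μ κ f x = ∫ y, κ (x - y) * f y ∂μ := by
  simp [smear, convolution_eq_swap]

theorem integrable_smear_integrand (hκ : Continuous κ) (hc : HasCompactSupport κ)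
    (hf : LocallyIntegrable f μ) (x : E) : Integrable (fun y => κ (x - y) * f y) μ :=
  (hc.convolutionExists_left (ContinuousLinearMap.lsmul ℝ ℝ) hκ hf x).integrable_swap

theorem contDiff_smear {n : ℕ∞} (hκ : ContDiff ℝ n κ) (hc : HasCompactSupport κ)
    (hf : LocallyIntegrable f μ) : ContDiff ℝ n (smear μ κ f) :=
  hc.contDiff_convolution_left _ hκ hf

theorem dirDeriv_smear (hκ : ContDiff ℝ 1 κ) (hc : HasCompactSupport κ)
    (hf : LocallyIntegrable f μ) (e : E) :
    dirDeriv e (smear μ κ f) = smear μ (dirDeriv e κ) f := by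
  funext x
  have h := hc.hasFDerivAt_convolution_left (ContinuousLinearMap.lsmul ℝ ℝ) hκ hf x
  have hi : Integrable (fun t => ((ContinuousLinearMap.lsmul ℝ ℝ : ℝ →L[ℝ] ℝ →L[ℝ] ℝ).precompL E
      (fderiv ℝ κ (x - t))) (f t)) μ :=
    ((hc.fderiv (𝕜 := ℝ)).convolutionExists_left _ (hκ.continuous_fderiv (by norm_num)) hf
      x).integrable_swap
  rw [dirDeriv, smear, h.fderiv, smear_apply, convolution_eq_swap,
    ContinuousLinearMap.integral_apply hi]
  refine integral_congr_ae (ae_of_all _ fun y => ?_)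
  simp [dirDeriv, ContinuousLinearMap.precompL_apply]

theorem integrable_smear (hκ : Integrable κ μ) (hf : Integrable f μ) :
    Integrable (smear μ κ f) μ :=
  hκ.integrable_convolution _ hf

theorem integral_smear (hκ : Integrable κ μ) (hf : Integrable f μ) :
    ∫ x, smear μ κ f x ∂μ = (∫ x, κ x ∂μ) * ∫ x, f x ∂μ := by
  simpa [smear] using integral_convolution (ContinuousLinearMap.lsmul ℝ ℝ) hκ hf

/-- A weighted Cauchy-Schwarz inequality for averages. -/
theorem sq_smear_le {g w : E → ℝ} (hκ : Continuous κ) (hc : HasCompactSupport κ)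
    (h0 : ∀ x, 0 ≤ κ x) (hw0 : ∀ x, 0 ≤ w x) (hw : LocallyIntegrable w μ)
    (hg : LocallyIntegrable (fun y => |g y| * w y) μ)
    (hg2 : LocallyIntegrable (fun y => g y ^ 2 * w y) μ) (x : E) :
    smear μ κ (fun y => |g y| * w y) x ^ 2 ≤
      smear μ κ w x * smear μ κ (fun y => g y ^ 2 * w y) x := by
  have i0 := integrable_smear_integrand μ hκ hc hw x
  have i1 := integrable_smear_integrand μ hκ hc hg x
  have i2 := integrable_smear_integrand μ hκ hc hg2 x
  -- The average of `w (t - |g|)²` is a nonnegative quadratic polynomial in `t`; its discriminant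
  -- gives the inequality.
  have key : ∀ t : ℝ, 0 ≤ smear μ κ w x * (t * t) +
      (-2 * smear μ κ (fun y => |g y| * w y) x) * t + smear μ κ (fun y => g y ^ 2 * w y) x := by
    intro t
    have : smear μ κ w x * (t * t) + (-2 * smear μ κ (fun y => |g y| * w y) x) * t +
        smear μ κ (fun y => g y ^ 2 * w y) x =
        ∫ y, κ (x - y) * (w y * (t - |g y|) ^ 2) ∂μ := by
      have e : ∀ y, κ (x - y) * (w y * (t - |g y|) ^ 2) =
          (t * t) * (κ (x - y) * w y) + (-2 * t) * (κ (x - y) * (|g y| * w y)) +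
            κ (x - y) * (g y ^ 2 * w y) := by
        intro y
        rw [← sq_abs (g y)]
        ring
      have i01 : Integrable (fun y => (t * t) * (κ (x - y) * w y) +
          (-2 * t) * (κ (x - y) * (|g y| * w y))) μ := (i0.const_mul _).add (i1.const_mul _)
      simp_rw [e]
      rw [integral_add i01 i2,
        integral_add (i0.const_mul _) (i1.const_mul _), integral_const_mul, integral_const_mul]
      simp only [smear_apply]
      ring
    rw [this]
    exact integral_nonneg fun y => mul_nonneg (h0 _) (mul_nonneg (hw0 _) (sq_nonneg _))
  have := discrim_le_zero key
  rw [discrim] at this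
  nlinarith

end Smear

/-! ### Weak solutions of `L g = c` and the equation satisfied by their mollification. -/

section Weak

variable {E : Type*} [NormedAddCommGroup E] [NormedSpace ℝ E] [FiniteDimensional ℝ E]
  [MeasurableSpace E] [BorelSpace E] {μ : Measure E} [μ.IsAddHaarMeasure]
  {ι : Type*} [Fintype ι] {v : ι → E} {H g : E → ℝ} {c : ℝ}

/-- `g` is a square integrable weak solution of `L g = c`. -/
structure WeakSolution (μ : Measure E) (v : ι → E) (H g : E → ℝ) (c : ℝ) : Prop where
  contDiff : ContDiff ℝ 2 H
  integrable_weight : Integrable (fun x => Real.exp (-(H x))) μ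
  measurable : AEStronglyMeasurable g μ
  integrable_sq : Integrable (fun x => g x ^ 2 * Real.exp (-(H x))) μ
  weak : ∀ u : E → ℝ, ContDiff ℝ ∞ u → HasCompactSupport u →
    ∫ x, g x * driftLaplacian v H u x * Real.exp (-(H x)) ∂μ = c * ∫ x, u x * Real.exp (-(H x)) ∂μ

/-- The mollification `(κ * (g e^{-H})) e^H` of `g`. -/
noncomputable def regularized (μ : Measure E) (H g κ : E → ℝ) : E → ℝ :=
  fun x => smear μ κ (fun y => g y * Real.exp (-(H y))) x * Real.exp (H x)

/-- The commutator `κ * (g e^{-H} ∂_e H) - (κ * (g e^{-H})) ∂_e H`. -/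
noncomputable def commutator (μ : Measure E) (H g κ : E → ℝ) (e : E) : E → ℝ :=
  fun x => smear μ κ (fun y => g y * Real.exp (-(H y)) * dirDeriv e H y) x -
    smear μ κ (fun y => g y * Real.exp (-(H y))) x * dirDeriv e H x

namespace WeakSolution

theorem continuous_weight (h : WeakSolution μ v H g c) :
    Continuous fun x => Real.exp (-(H x)) :=
  h.contDiff.continuous.neg.rexp

theorem continuous_dirDeriv (h : WeakSolution μ v H g c) (e : E) : Continuous (dirDeriv e H) :=
  (contDiff_dirDeriv (m := 1) h.contDiff (by norm_num) e).continuous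

theorem integrable_density (h : WeakSolution μ v H g c) :
    Integrable (fun x => g x * Real.exp (-(H x))) μ := by
  refine (h.integrable_weight.add h.integrable_sq).mono'
    (h.measurable.mul h.continuous_weight.aestronglyMeasurable) (ae_of_all _ fun x => ?_)
  have hw := Real.exp_pos (-(H x))
  simp only [Pi.add_apply, Real.norm_eq_abs, abs_mul, abs_of_pos hw]
  have : |g x| ≤ 1 + g x ^ 2 := by nlinarith [sq_abs (g x), sq_nonneg (|g x| - 1), abs_nonneg (g x)]
  nlinarith

theorem locallyIntegrable_density (h : WeakSolution μ v H g c) :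
    LocallyIntegrable (fun x => g x * Real.exp (-(H x))) μ :=
  h.integrable_density.locallyIntegrable

theorem locallyIntegrable_density_mul (h : WeakSolution μ v H g c) {q : E → ℝ}
    (hq : Continuous q) :
    LocallyIntegrable (fun x => g x * Real.exp (-(H x)) * q x) μ := by
  rw [← locallyIntegrableOn_univ]
  exact (h.locallyIntegrable_density.locallyIntegrableOn _).mul_continuousOn hq.continuousOn
    isClosed_univ.isLocallyClosed

/-- The mollified equation, in divergence form. -/
theorem sum_dirDeriv_flux (h : WeakSolution μ v H g c) {κ : E → ℝ} (hκ : ContDiff ℝ ∞ κ)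
    (hc : HasCompactSupport κ) (x : E) :
    ∑ b, dirDeriv (v b) (fun x => dirDeriv (v b) (smear μ κ fun y => g y * Real.exp (-(H y))) x +
      smear μ κ (fun y => g y * Real.exp (-(H y)) * dirDeriv (v b) H y) x) x =
      -(c * smear μ κ (fun y => Real.exp (-(H y))) x) := by
  have hκ1 : ContDiff ℝ 1 κ := hκ.of_le (by exact_mod_cast le_top)
  have dκ (e : E) : ContDiff ℝ ∞ (dirDeriv e κ) := contDiff_dirDeriv hκ (by simp) e
  have cκ (e : E) : HasCompactSupport (dirDeriv e κ) := hasCompactSupport_dirDeriv hc e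
  have ddκ (e : E) : ContDiff ℝ ∞ (dirDeriv e (dirDeriv e κ)) := contDiff_dirDeriv (dκ e) (by simp) e
  have l0 := h.locallyIntegrable_density
  have lb (e : E) := h.locallyIntegrable_density_mul (h.continuous_dirDeriv e)
  have hu : ContDiff ℝ ∞ fun y => κ (x - y) := hκ.comp (contDiff_const.sub contDiff_id)
  have hcu : HasCompactSupport fun y => κ (x - y) :=
    hc.comp_homeomorph (Homeomorph.subLeft x)
  have du (q : E → ℝ) (hq : ContDiff ℝ ∞ q) (e : E) :
      dirDeriv e (fun y => q (x - y)) = fun y => -dirDeriv e q (x - y) := by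
    funext y
    have h1 : HasFDerivAt q (fderiv ℝ q (x - y)) (x - y) :=
      (hq.differentiable (by simp) _).hasFDerivAt
    have h2 : HasFDerivAt (fun y => x - y) (-(ContinuousLinearMap.id ℝ E)) y := by
      simpa using (hasFDerivAt_id (𝕜 := ℝ) y).const_sub x
    have h3 : HasFDerivAt (fun y => q (x - y)) _ y := h1.comp y h2
    simp only [dirDeriv]
    rw [h3.fderiv]
    simp
  have dneg (q : E → ℝ) (e : E) : dirDeriv e (fun y => -q y) = fun y => -dirDeriv e q y := by
    funext y
    simp [dirDeriv, fderiv_fun_neg]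
  -- The test function `y ↦ κ (x - y)` turns the weak equation into a pointwise identity for
  -- convolutions at `x`.
  have key := h.weak _ hu hcu
  have e1 : ∀ y, g y * driftLaplacian v H (fun y => κ (x - y)) y * Real.exp (-(H y)) =
      -∑ b, (dirDeriv (v b) (dirDeriv (v b) κ) (x - y) * (g y * Real.exp (-(H y))) +
        dirDeriv (v b) κ (x - y) * (g y * Real.exp (-(H y)) * dirDeriv (v b) H y)) := by
    intro y
    rw [driftLaplacian, Finset.mul_sum, Finset.sum_mul, ← Finset.sum_neg_distrib]
    refine Finset.sum_congr rfl fun b _ => ?_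
    rw [du κ hκ, dneg, du _ (dκ _)]
    ring
  simp_rw [e1] at key
  have ib (b : ι) : Integrable (fun y => dirDeriv (v b) (dirDeriv (v b) κ) (x - y) *
      (g y * Real.exp (-(H y))) +
        dirDeriv (v b) κ (x - y) * (g y * Real.exp (-(H y)) * dirDeriv (v b) H y)) μ :=
    (integrable_smear_integrand μ (ddκ _).continuous
      (hasCompactSupport_dirDeriv (cκ _) _) l0 x).add
      (integrable_smear_integrand μ (dκ _).continuous (cκ _) (lb _) x)
  rw [integral_neg, integral_finsetSum _ fun b _ => ib b] at key
  rw [smear_apply, ← key, neg_neg]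
  refine Finset.sum_congr rfl fun b _ => ?_
  rw [dirDeriv_smear μ hκ1 hc l0, dirDeriv_add
    ((contDiff_smear μ (n := 1) ((dκ _).of_le (by exact_mod_cast le_top)) (cκ _)
      l0).differentiable (by norm_num))
    ((contDiff_smear μ (n := 1) hκ1 hc (lb _)).differentiable (by norm_num)),
    dirDeriv_smear μ ((dκ _).of_le (by exact_mod_cast le_top)) (cκ _) l0,
    dirDeriv_smear μ hκ1 hc (lb _)]
  dsimp only
  rw [smear_apply, smear_apply, integral_add
    (integrable_smear_integrand μ (ddκ _).continuous
      (hasCompactSupport_dirDeriv (cκ _) _) l0 x)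
      (integrable_smear_integrand μ (dκ _).continuous (cκ _) (lb _) x)]

theorem contDiff_regularized (h : WeakSolution μ v H g c) {κ : E → ℝ} (hκ : ContDiff ℝ ∞ κ)
    (hc : HasCompactSupport κ) : ContDiff ℝ 2 (regularized μ H g κ) :=
  (contDiff_smear μ (n := 2) (hκ.of_le (by exact_mod_cast le_top)) hc
    h.locallyIntegrable_density).mul h.contDiff.exp

theorem continuous_commutator (h : WeakSolution μ v H g c) {κ : E → ℝ} (hκ : ContDiff ℝ ∞ κ)
    (hc : HasCompactSupport κ) (e : E) : Continuous (commutator μ H g κ e) :=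
  (contDiff_smear μ hκ hc
    (h.locallyIntegrable_density_mul (h.continuous_dirDeriv e))).continuous.sub
    ((contDiff_smear μ hκ hc h.locallyIntegrable_density).continuous.mul (h.continuous_dirDeriv e))

/-- The product rule applied to `γ = (κ * (g e^{-H})) e^H`. The flux becomes the expected `e^{-H}
∂_e γ` plus an error that only measures how much `∂_e H` varies over the support of the kernel. -/
theorem flux_eq (h : WeakSolution μ v H g c) {κ : E → ℝ} (hκ : ContDiff ℝ ∞ κ)
    (hc : HasCompactSupport κ) (e x : E) :
    dirDeriv e (smear μ κ fun y => g y * Real.exp (-(H y))) x +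
      smear μ κ (fun y => g y * Real.exp (-(H y)) * dirDeriv e H y) x =
      Real.exp (-(H x)) * dirDeriv e (regularized μ H g κ) x + commutator μ H g κ e x := by
  have hH : DifferentiableAt ℝ H x := h.contDiff.differentiable (by norm_num) x
  have d1 : DifferentiableAt ℝ (smear μ κ fun y => g y * Real.exp (-(H y))) x :=
    (contDiff_smear μ hκ hc h.locallyIntegrable_density).differentiable (by simp) x
  have d2 : dirDeriv e (fun y => Real.exp (H y)) x = Real.exp (H x) * dirDeriv e H x := by
    simp [dirDeriv, hH.hasFDerivAt.exp.fderiv]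
  have : dirDeriv e (regularized μ H g κ) x = smear μ κ (fun y => g y * Real.exp (-(H y))) x *
      (Real.exp (H x) * dirDeriv e H x) +
      dirDeriv e (smear μ κ fun y => g y * Real.exp (-(H y))) x * Real.exp (H x) := by
    rw [← d2]
    exact dirDeriv_mul d1 hH.exp e
  rw [this, commutator]
  have hE : Real.exp (-(H x)) * Real.exp (H x) = 1 := by rw [← Real.exp_add]; simp
  linear_combination (-(smear μ κ (fun y => g y * Real.exp (-(H y))) x * dirDeriv e H x) -
    dirDeriv e (smear μ κ fun y => g y * Real.exp (-(H y))) x) * hE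

/-- The mollified equation, tested against a function with compact support. -/
theorem sum_integral_flux_mul (h : WeakSolution μ v H g c) {κ ψ : E → ℝ} (hκ : ContDiff ℝ ∞ κ)
    (hc : HasCompactSupport κ) (hψ : ContDiff ℝ 1 ψ) (hcψ : HasCompactSupport ψ) :
    ∑ b, ∫ x, (Real.exp (-(H x)) * dirDeriv (v b) (regularized μ H g κ) x +
      commutator μ H g κ (v b) x) * dirDeriv (v b) ψ x ∂μ =
      c * ∫ x, smear μ κ (fun y => Real.exp (-(H y))) x * ψ x ∂μ := by
  have cF (b : ι) : ContDiff ℝ 1 (fun x => dirDeriv (v b)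
      (smear μ κ fun y => g y * Real.exp (-(H y))) x +
      smear μ κ (fun y => g y * Real.exp (-(H y)) * dirDeriv (v b) H y) x) :=
    (contDiff_dirDeriv (contDiff_smear μ (n := 2) (hκ.of_le (by exact_mod_cast le_top)) hc
      h.locallyIntegrable_density) (by norm_num) _).add
    (contDiff_smear μ (n := 1) (hκ.of_le (by exact_mod_cast le_top)) hc
      (h.locallyIntegrable_density_mul (h.continuous_dirDeriv _)))
  simp_rw [← h.flux_eq hκ hc]
  have : ∀ b, ∫ x, (dirDeriv (v b) (smear μ κ fun y => g y * Real.exp (-(H y))) x +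
      smear μ κ (fun y => g y * Real.exp (-(H y)) * dirDeriv (v b) H y) x) * dirDeriv (v b) ψ x ∂μ =
      -∫ x, dirDeriv (v b) (fun x => dirDeriv (v b)
      (smear μ κ fun y => g y * Real.exp (-(H y))) x +
      smear μ κ (fun y => g y * Real.exp (-(H y)) * dirDeriv (v b) H y) x) x * ψ x ∂μ := by
    intro b
    rw [integral_dirDeriv_mul μ (cF b) hψ hcψ, neg_neg]
  simp_rw [this]
  rw [Finset.sum_neg_distrib, ← integral_finsetSum, ← integral_const_mul, ← integral_neg]
  · refine integral_congr_ae (ae_of_all _ fun x => ?_)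
    dsimp only
    rw [← Finset.sum_mul, h.sum_dirDeriv_flux hκ hc]
    ring
  · intro b _
    exact ((contDiff_dirDeriv (m := 0) (cF b) (by norm_num) _).continuous.mul
      hψ.continuous).integrable_of_hasCompactSupport hcψ.mul_left

end WeakSolution

end Weak

/-! ### Cutoff functions. -/

section Cutoff

variable {E : Type*} [NormedAddCommGroup E] [NormedSpace ℝ E] [FiniteDimensional ℝ E]
  {ι : Type*} [Fintype ι]

/-- Smooth cutoff functions with small gradient. -/
theorem exists_cutoff (v : ι → E) (r : ℝ) {ε : ℝ} (hε : 0 < ε) :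
    ∃ χ : E → ℝ, ContDiff ℝ ∞ χ ∧ HasCompactSupport χ ∧ (∀ x, 0 ≤ χ x) ∧ (∀ x, χ x ≤ 1) ∧
      (∀ x ∈ Metric.closedBall (0 : E) r, χ x = 1) ∧ ∀ b x, |dirDeriv (v b) χ x| ≤ ε := by
  let φ : ContDiffBump (0 : E) := ⟨1, 2, one_pos, one_lt_two⟩
  have hφ : ContDiff ℝ ∞ φ := φ.contDiff
  have hb : ∀ b, ∃ C, ∀ x, ‖dirDeriv (v b) φ x‖ ≤ C := fun b =>
    (hasCompactSupport_dirDeriv φ.hasCompactSupport (v b)).exists_bound_of_continuous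
      (contDiff_dirDeriv (m := 0) hφ (by simp) _).continuous
  choose C hC using hb
  -- A fixed bump is dilated by `R`, which divides its gradient by `R`: the three bounds make `R`
  -- positive, the plateau contain the ball of radius `r`, and the gradient at most `ε`.
  let R : ℝ := max 1 (max r (∑ b, |C b| / ε))
  have hR1 : 1 ≤ R := le_max_left _ _
  have hR : 0 < R := by linarith
  have hRr : r ≤ R := (le_max_left _ _).trans (le_max_right _ _)
  have hRC (b : ι) : C b ≤ ε * R := by
    have h1 : |C b| / ε ≤ R :=
      (Finset.single_le_sum (f := fun b => |C b| / ε) (fun i _ => by positivity)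
        (Finset.mem_univ b)).trans ((le_max_right _ _).trans (le_max_right _ _))
    rw [div_le_iff₀ hε] at h1
    linarith [le_abs_self (C b)]
  refine ⟨fun x => φ (R⁻¹ • x), hφ.comp (contDiff_const_smul _),
    φ.hasCompactSupport.comp_homeomorph (Homeomorph.smulOfNeZero R⁻¹ (inv_ne_zero hR.ne')),
    fun x => φ.nonneg, fun x => φ.le_one, fun x hx => ?_, fun b x => ?_⟩
  · refine φ.one_of_mem_closedBall ?_
    have hx' : ‖x‖ ≤ r := by simpa using hx
    rw [mem_closedBall_zero_iff, norm_smul, norm_inv, Real.norm_of_nonneg hR.le]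
    change R⁻¹ * ‖x‖ ≤ 1
    rw [inv_mul_le_iff₀ hR]
    linarith
  · have h1 : HasFDerivAt (fun x : E => R⁻¹ • x) (R⁻¹ • ContinuousLinearMap.id ℝ E) x :=
      (hasFDerivAt_id x).const_smul _
    have h2 : HasFDerivAt (fun x : E => φ (R⁻¹ • x)) _ x :=
      ((hφ.differentiable (by simp)) (R⁻¹ • x)).hasFDerivAt.comp x h1
    have h3 : dirDeriv (v b) (fun x => φ (R⁻¹ • x)) x = R⁻¹ * dirDeriv (v b) φ (R⁻¹ • x) := by
      simp [dirDeriv, h2.fderiv]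
    rw [h3, abs_mul, abs_of_pos (inv_pos.2 hR), inv_mul_le_iff₀ hR, mul_comm]
    exact (hC b _).trans (hRC b)

end Cutoff

/-! ### Commutator bounds and the Caccioppoli inequality. -/

section Weak

variable {E : Type*} [NormedAddCommGroup E] [NormedSpace ℝ E] [FiniteDimensional ℝ E]
  [MeasurableSpace E] [BorelSpace E] {μ : Measure E} [μ.IsAddHaarMeasure]
  {ι : Type*} [Fintype ι] {v : ι → E} {H g : E → ℝ} {c : ℝ}

/-- Pointwise control of the mollification of `g` by averages. -/
structure MollifierBounds (μ : Measure E) (v : ι → E) (H g κ : E → ℝ) (η : ℝ) (x : E) : Prop where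
  lower : Real.exp (-(H x)) ≤ 2 * smear μ κ (fun y => Real.exp (-(H y))) x
  upper : smear μ κ (fun y => Real.exp (-(H y))) x ≤ 2 * Real.exp (-(H x))
  sol : Real.exp (-(H x)) * regularized μ H g κ x ^ 2 ≤
    2 * smear μ κ (fun y => g y ^ 2 * Real.exp (-(H y))) x
  comm : ∀ b, commutator μ H g κ (v b) x ^ 2 ≤
    2 * η ^ 2 * Real.exp (-(H x)) * smear μ κ (fun y => g y ^ 2 * Real.exp (-(H y))) x

namespace WeakSolution

/-- `H` and the `∂_b H` are uniformly continuous near a compact ball, so a kernel of small radius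
sees `e^{-H}` as constant up to a factor 3/2 and `∂_b H` as constant up to `η`. Weighted
Cauchy-Schwarz then controls the averages of `g` by that of `g²`. The radius `δ` does not depend on
the choice of kernel. -/
theorem exists_mollifierBounds (h : WeakSolution μ v H g c) (r : ℝ) {η : ℝ} (hη : 0 < η) :
    ∃ δ > 0, ∀ φ : ContDiffBump (0 : E), φ.rOut < δ → ∀ x ∈ Metric.closedBall (0 : E) r,
      MollifierBounds μ v H g (φ.normed μ) η x := by
  have hK : IsCompact (Metric.closedBall (0 : E) r) := isCompact_closedBall _ _
  have u1 := hK.uniformContinuousAt_of_continuousAt H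
    (fun x _ => h.contDiff.continuous.continuousAt)
    (Metric.dist_mem_uniformity (Real.log_pos (by norm_num : (1 : ℝ) < 3 / 2)))
  have u2 := fun b => hK.uniformContinuousAt_of_continuousAt (dirDeriv (v b) H)
    (fun x _ => (h.continuous_dirDeriv (v b)).continuousAt) (Metric.dist_mem_uniformity hη)
  have u := Filter.inter_mem u1 (Filter.iInter_mem.2 u2)
  obtain ⟨δ, hδ, hδ'⟩ := Metric.mem_uniformity_dist.1 u
  refine ⟨δ, hδ, fun φ hφ x hx => ?_⟩
  have hH : ∀ y ∈ Metric.ball x φ.rOut, |H x - H y| < Real.log (3 / 2) := fun y hy =>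
    (hδ' ((Metric.mem_ball'.1 hy).trans hφ)).1 hx
  have hD : ∀ y ∈ Metric.ball x φ.rOut, ∀ b, |dirDeriv (v b) H x - dirDeriv (v b) H y| ≤ η :=
    fun y hy b => (Set.mem_iInter.1 (hδ' ((Metric.mem_ball'.1 hy).trans hφ)).2 b hx).le
  set κ := φ.normed μ
  set P := smear μ κ (fun y => g y ^ 2 * Real.exp (-(H y))) x
  set I := smear μ κ (fun y => Real.exp (-(H y))) x
  have κc : Continuous κ := φ.continuous_normed
  have κs : HasCompactSupport κ := φ.hasCompactSupport_normed
  have κ0 : ∀ x, 0 ≤ κ x := φ.nonneg_normed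
  have hw := Real.exp_pos (-(H x))
  have hE : Real.exp (-(H x)) * Real.exp (H x) = 1 := by rw [← Real.exp_add]; simp
  -- The ratio `e^{H x - H y}` lies in `[2/3, 3/2]`, hence within 1/2 of 1.
  have hI : dist I (Real.exp (-(H x))) ≤ Real.exp (-(H x)) / 2 := by
    refine φ.dist_normed_convolution_le (g := fun y => Real.exp (-(H y)))
      h.continuous_weight.aestronglyMeasurable fun y hy => ?_
    have hy' := abs_lt.1 (hH y hy)
    have e1 : Real.exp (-(H y)) = Real.exp (-(H x)) * Real.exp (H x - H y) := by
      rw [← Real.exp_add]; ring_nf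
    have e2 : Real.exp (H x - H y) ≤ 3 / 2 := by
      rw [← Real.exp_log (by norm_num : (0 : ℝ) < 3 / 2)]
      exact Real.exp_le_exp.2 hy'.2.le
    have e3 : 2 / 3 ≤ Real.exp (H x - H y) := by
      have : (2 / 3 : ℝ) = Real.exp (-Real.log (3 / 2)) := by
        rw [Real.exp_neg, Real.exp_log (by norm_num)]; norm_num
      rw [this]
      exact Real.exp_le_exp.2 hy'.1.le
    rw [Real.dist_eq, e1, abs_le]
    constructor <;> nlinarith
  rw [Real.dist_eq, abs_le] at hI
  have lw : LocallyIntegrable (fun y => Real.exp (-(H y))) μ := h.integrable_weight.locallyIntegrable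
  have l0 := h.locallyIntegrable_density
  have labs : LocallyIntegrable (fun y => |g y| * Real.exp (-(H y))) μ := by
    have : (fun y => |g y| * Real.exp (-(H y))) = fun y => ‖g y * Real.exp (-(H y))‖ := by
      funext y
      rw [norm_mul, Real.norm_eq_abs, Real.norm_of_nonneg (Real.exp_pos _).le]
    rw [this]
    exact h.integrable_density.norm.locallyIntegrable
  have hP0 : 0 ≤ P := by
    simp only [P, smear_apply]
    exact integral_nonneg fun y => mul_nonneg (κ0 _) (by positivity)
  have hJ : smear μ κ (fun y => |g y| * Real.exp (-(H y))) x ^ 2 ≤ 2 * Real.exp (-(H x)) * P := by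
    refine (sq_smear_le μ κc κs κ0 (fun y => (Real.exp_pos _).le) lw labs
      h.integrable_sq.locallyIntegrable x).trans ?_
    exact mul_le_mul_of_nonneg_right (by linarith) hP0
  have hG : |smear μ κ (fun y => g y * Real.exp (-(H y))) x| ≤
      smear μ κ (fun y => |g y| * Real.exp (-(H y))) x := by
    rw [smear_apply, smear_apply]
    refine (abs_integral_le_integral_abs).trans (le_of_eq ?_)
    refine integral_congr_ae (ae_of_all _ fun y => ?_)
    simp only [abs_mul, abs_of_nonneg (κ0 _), Real.abs_exp]
  refine ⟨by linarith, by linarith, ?_, fun b => ?_⟩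
  · have h1 := (sq_le_sq' (abs_le.1 hG).1 (abs_le.1 hG).2).trans hJ
    rw [regularized, mul_pow]
    calc _ = smear μ κ (fun y => g y * Real.exp (-(H y))) x ^ 2 * Real.exp (H x) *
          (Real.exp (-(H x)) * Real.exp (H x)) := by ring
      _ ≤ 2 * Real.exp (-(H x)) * P * Real.exp (H x) * (Real.exp (-(H x)) * Real.exp (H x)) := by
          gcongr
      _ = 2 * P * (Real.exp (-(H x)) * Real.exp (H x)) ^ 2 := by ring
      _ = 2 * P := by rw [hE]; ring
  · have i1 := integrable_smear_integrand μ κc κs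
      (h.locallyIntegrable_density_mul (h.continuous_dirDeriv (v b))) x
    have i2 := integrable_smear_integrand μ κc κs l0 x
    have i3 := integrable_smear_integrand μ κc κs labs x
    -- The commutator is one integral with factor `∂_b H y - ∂_b H x`, which is at most `η` in size
    -- wherever the kernel does not vanish.
    have hR : |commutator μ H g κ (v b) x| ≤
        η * smear μ κ (fun y => |g y| * Real.exp (-(H y))) x := by
      rw [commutator, smear_apply, smear_apply, smear_apply, ← integral_mul_const,
        ← integral_sub i1 (i2.mul_const _), ← integral_const_mul, ← Real.norm_eq_abs]
      refine norm_integral_le_of_norm_le (i3.const_mul η) (ae_of_all _ fun y => ?_)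
      have e : κ (x - y) * (g y * Real.exp (-(H y)) * dirDeriv (v b) H y) -
          κ (x - y) * (g y * Real.exp (-(H y))) * dirDeriv (v b) H x =
          -(κ (x - y) * (g y * Real.exp (-(H y))) *
            (dirDeriv (v b) H x - dirDeriv (v b) H y)) := by ring
      rw [e, norm_neg]
      simp only [Real.norm_eq_abs, abs_mul, abs_of_nonneg (κ0 _), Real.abs_exp]
      by_cases hy : κ (x - y) = 0
      · simp [hy]
      · have hy1 : x - y ∈ Metric.ball (0 : E) φ.rOut := by
          rw [← φ.support_normed_eq (μ := μ)]; exact hy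
        have hy2 : y ∈ Metric.ball x φ.rOut := by
          rw [mem_ball_iff_norm']; simpa using hy1
        have := mul_le_mul_of_nonneg_left (hD y hy2 b)
          (mul_nonneg (κ0 (x - y)) (mul_nonneg (abs_nonneg (g y)) (Real.exp_pos (-(H y))).le))
        linarith
    have h1 := sq_le_sq' (abs_le.1 hR).1 (abs_le.1 hR).2
    calc _ ≤ _ := h1
      _ = η ^ 2 * smear μ κ (fun y => |g y| * Real.exp (-(H y))) x ^ 2 := by ring
      _ ≤ η ^ 2 * (2 * Real.exp (-(H x)) * P) := by gcongr
      _ = _ := by ring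

theorem integrable_smear_sq (h : WeakSolution μ v H g c) (φ : ContDiffBump (0 : E)) :
    Integrable (smear μ (φ.normed μ) fun y => g y ^ 2 * Real.exp (-(H y))) μ :=
  integrable_smear μ φ.integrable_normed h.integrable_sq

theorem integral_smear_sq (h : WeakSolution μ v H g c) (φ : ContDiffBump (0 : E)) :
    ∫ x, smear μ (φ.normed μ) (fun y => g y ^ 2 * Real.exp (-(H y))) x ∂μ =
      ∫ x, g x ^ 2 * Real.exp (-(H x)) ∂μ := by
  rw [integral_smear μ φ.integrable_normed h.integrable_sq, φ.integral_normed, one_mul]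

theorem smear_sq_nonneg (φ : ContDiffBump (0 : E)) (x : E) :
    0 ≤ smear μ (φ.normed μ) (fun y => g y ^ 2 * Real.exp (-(H y))) x := by
  rw [smear_apply]
  exact integral_nonneg fun y => mul_nonneg (φ.nonneg_normed _) (by positivity)

/-- The pointwise core of the Caccioppoli inequality: `w` stands for `e^{-H}`, `p` for `∂_b γ`, `R`
for the commutator, `t` and `s` for the cutoff and its derivative, `P` for the mollified `g²
e^{-H}`. The right side is the flux times the derivative of `χ² γ`. -/
theorem flux_mul_ge {w p R t s γ P η κ₀ : ℝ} (hw : 0 < w) (ht0 : 0 ≤ t) (ht : t ≤ 1)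
    (hs : |s| ≤ κ₀) (hγ : w * γ ^ 2 ≤ 2 * P) (hR : R ^ 2 ≤ 2 * η ^ 2 * w * P) :
    w * t ^ 2 * p ^ 2 / 2 - (10 * κ₀ ^ 2 + 4 * η ^ 2) * P ≤
      (w * p + R) * (t ^ 2 * p + 2 * t * s * γ) := by
  obtain ⟨q, rfl⟩ : ∃ q, R = w * q := ⟨R / w, by field_simp⟩
  have hq : w * q ^ 2 ≤ 2 * η ^ 2 * P := by
    refine le_of_mul_le_mul_left ?_ hw
    nlinarith
  have hs2 : s ^ 2 ≤ κ₀ ^ 2 := by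
    rw [← sq_abs s]; exact pow_le_pow_left₀ (abs_nonneg s) hs 2
  have ht2 : t ^ 2 ≤ 1 := pow_le_one₀ ht0 ht
  have h1 : s ^ 2 * (w * γ ^ 2) ≤ κ₀ ^ 2 * (2 * P) :=
    mul_le_mul hs2 hγ (by positivity) (by positivity)
  have h2 : t ^ 2 * (w * q ^ 2) ≤ 1 * (2 * η ^ 2 * P) :=
    mul_le_mul ht2 hq (by positivity) (by positivity)
  -- With `R = w q`, the right side is `w t² p² / 2` plus this expression minus `w (5 s² γ² + 2 t²
  -- q²)`; the bounds `h1` and `h2` then give 10 = 5·2 and 4 = 2·2.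
  have h3 : 0 ≤ w * ((t * p / 2 + 2 * (s * γ)) ^ 2 + (t * p / 2 + t * q) ^ 2 +
      (s * γ + t * q) ^ 2) := by positivity
  nlinarith

/-- The Caccioppoli inequality for the mollified solution. -/
theorem sum_integral_sq_le (h : WeakSolution μ v H g c) {χ : E → ℝ} {κ₀ η : ℝ}
    (φ : ContDiffBump (0 : E)) (hχ : ContDiff ℝ ∞ χ) (hcχ : HasCompactSupport χ)
    (h0 : ∀ x, 0 ≤ χ x) (h1 : ∀ x, χ x ≤ 1) (hd : ∀ b x, |dirDeriv (v b) χ x| ≤ κ₀)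
    (hb : ∀ x ∈ tsupport χ, MollifierBounds μ v H g (φ.normed μ) η x) :
    ∑ b, ∫ x, Real.exp (-(H x)) * χ x ^ 2 *
        dirDeriv (v b) (regularized μ H g (φ.normed μ)) x ^ 2 ∂μ ≤
      2 * (Fintype.card ι * ((10 * κ₀ ^ 2 + 4 * η ^ 2) * ∫ x, g x ^ 2 * Real.exp (-(H x)) ∂μ) +
        |c| * ((∫ x, Real.exp (-(H x)) ∂μ) + 2 * ∫ x, g x ^ 2 * Real.exp (-(H x)) ∂μ)) := by
  set κ := φ.normed μ
  set γ := regularized μ H g κ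
  set P := smear μ κ (fun y => g y ^ 2 * Real.exp (-(H y)))
  set M := ∫ x, g x ^ 2 * Real.exp (-(H x)) ∂μ
  have hκ : ContDiff ℝ ∞ κ := φ.contDiff_normed
  have κs : HasCompactSupport κ := φ.hasCompactSupport_normed
  have hP0 : ∀ x, 0 ≤ P x := smear_sq_nonneg φ
  have hPi : Integrable P μ := h.integrable_smear_sq φ
  have hPM : ∫ x, P x ∂μ = M := h.integral_smear_sq φ
  have hγ : ContDiff ℝ 2 γ := h.contDiff_regularized hκ κs
  have cγ (b : ι) : Continuous (dirDeriv (v b) γ) :=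
    (contDiff_dirDeriv (m := 1) hγ (by norm_num) _).continuous
  have hχ1 : ContDiff ℝ 1 χ := hχ.of_le (by exact_mod_cast le_top)
  have hψ : ContDiff ℝ 1 fun x => χ x ^ 2 * γ x := (hχ1.pow 2).mul (hγ.of_le (by norm_num))
  have hχ2 : HasCompactSupport fun x => χ x ^ 2 := hcχ.comp_left (g := fun t => t ^ 2) (by simp)
  have hcψ : HasCompactSupport fun x => χ x ^ 2 * γ x := hχ2.mul_right
  -- The mollified equation is tested with `χ² γ`.
  have key := h.sum_integral_flux_mul hκ κs hψ hcψ
  have dψ (b : ι) (x : E) : dirDeriv (v b) (fun x => χ x ^ 2 * γ x) x =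
      χ x ^ 2 * dirDeriv (v b) γ x + 2 * χ x * dirDeriv (v b) χ x * γ x := by
    have hχd := hχ1.differentiable (by norm_num) x
    have e : (fun x => χ x ^ 2) = fun x => χ x * χ x := by funext; ring
    rw [dirDeriv_mul (f := fun x => χ x ^ 2) (hχd.pow 2) (hγ.differentiable (by norm_num) x), e,
      dirDeriv_mul hχd hχd]
    ring
  have i1 (b : ι) : Integrable (fun x => Real.exp (-(H x)) * χ x ^ 2 * dirDeriv (v b) γ x ^ 2) μ :=
    ((h.continuous_weight.mul (hχ1.continuous.pow 2)).mul
      ((cγ b).pow 2)).integrable_of_hasCompactSupport (hχ2.mul_left.mul_right)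
  have i2 (b : ι) : Integrable (fun x => (Real.exp (-(H x)) * dirDeriv (v b) γ x +
      commutator μ H g κ (v b) x) * dirDeriv (v b) (fun x => χ x ^ 2 * γ x) x) μ :=
    (((h.continuous_weight.mul (cγ b)).add (h.continuous_commutator hκ κs _)).mul
      (contDiff_dirDeriv (m := 0) hψ (by norm_num) _).continuous).integrable_of_hasCompactSupport
      (hasCompactSupport_dirDeriv hcψ _).mul_left
  have low (b : ι) : (∫ x, Real.exp (-(H x)) * χ x ^ 2 * dirDeriv (v b) γ x ^ 2 ∂μ) / 2 -
      (10 * κ₀ ^ 2 + 4 * η ^ 2) * M ≤ ∫ x, (Real.exp (-(H x)) * dirDeriv (v b) γ x +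
      commutator μ H g κ (v b) x) * dirDeriv (v b) (fun x => χ x ^ 2 * γ x) x ∂μ := by
    rw [← hPM, ← integral_div, ← integral_const_mul,
      ← integral_sub ((i1 b).div_const _) (hPi.const_mul _)]
    refine integral_mono (((i1 b).div_const _).sub (hPi.const_mul _)) (i2 b) fun x => ?_
    simp only [dψ]
    by_cases hx : x ∈ tsupport χ
    · exact flux_mul_ge (Real.exp_pos _) (h0 x) (h1 x) (hd b x) (hb x hx).sol
        ((hb x hx).comm b)
    · have : 0 ≤ (10 * κ₀ ^ 2 + 4 * η ^ 2) * P x := mul_nonneg (by positivity) (hP0 x)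
      simp only [image_eq_zero_of_notMem_tsupport hx]
      norm_num
      linarith
  have up : c * ∫ x, smear μ κ (fun y => Real.exp (-(H y))) x * (χ x ^ 2 * γ x) ∂μ ≤
      |c| * ((∫ x, Real.exp (-(H x)) ∂μ) + 2 * M) := by
    refine (le_abs_self _).trans ?_
    rw [abs_mul]
    refine mul_le_mul_of_nonneg_left ?_ (abs_nonneg c)
    rw [← hPM, ← integral_const_mul, ← integral_add h.integrable_weight (hPi.const_mul 2),
      ← Real.norm_eq_abs]
    refine norm_integral_le_of_norm_le (h.integrable_weight.add (hPi.const_mul 2))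
      (ae_of_all _ fun x => ?_)
    have hw := Real.exp_pos (-(H x))
    by_cases hx : x ∈ tsupport χ
    · have hI0 : 0 ≤ smear μ κ (fun y => Real.exp (-(H y))) x := by
        have := (hb x hx).lower
        linarith
      have hs := (hb x hx).sol
      rw [Real.norm_eq_abs, abs_mul, abs_mul, abs_of_nonneg hI0, abs_of_nonneg (sq_nonneg (χ x))]
      have a1 : χ x ^ 2 * |γ x| ≤ |γ x| :=
        mul_le_of_le_one_left (abs_nonneg _) (pow_le_one₀ (h0 x) (h1 x))
      have a2 : smear μ κ (fun y => Real.exp (-(H y))) x * (χ x ^ 2 * |γ x|) ≤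
          2 * Real.exp (-(H x)) * |γ x| :=
        mul_le_mul (hb x hx).upper a1 (by positivity) (by positivity)
      -- `2 |γ| ≤ 1 + γ²`, and `e^{-H} γ² ≤ 2 P` by `MollifierBounds.sol`.
      have a3 : 0 ≤ Real.exp (-(H x)) * (1 - |γ x|) ^ 2 := by positivity
      rw [← sq_abs] at hs
      nlinarith
    · simp only [image_eq_zero_of_notMem_tsupport hx]
      have := hP0 x
      norm_num
      positivity
  have hsum := Finset.sum_le_sum fun b (_ : b ∈ Finset.univ) => low b
  rw [key, Finset.sum_sub_distrib, ← Finset.sum_div, Finset.sum_const, Finset.card_univ,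
    nsmul_eq_mul] at hsum
  linarith

end WeakSolution

end Weak

/-! ### Liouville theorem: square integrable weak solutions are constant. -/

section Weak

variable {E : Type*} [NormedAddCommGroup E] [NormedSpace ℝ E] [FiniteDimensional ℝ E]
  [MeasurableSpace E] [BorelSpace E] {μ : Measure E} [μ.IsAddHaarMeasure]
  {ι : Type*} [Fintype ι] {v : ι → E} {H g : E → ℝ} {c : ℝ}

theorem exists_contDiffBump_rOut_lt {δ : ℝ} (hδ : 0 < δ) : ∃ φ : ContDiffBump (0 : E), φ.rOut < δ :=
  ⟨⟨δ / 4, δ / 2, by positivity, by linarith⟩, by change δ / 2 < δ; linarith⟩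

theorem exists_tsupport_subset_closedBall {f : E → ℝ} (hf : HasCompactSupport f) :
    ∃ r, tsupport f ⊆ Metric.closedBall (0 : E) r :=
  hf.isCompact.isBounded.subset_closedBall 0

theorem eq_zero_of_forall_le_mul {a B : ℝ} (ha : 0 ≤ a) (h : ∀ ε, 0 < ε → ε ≤ 1 → a ≤ ε * B) :
    a = 0 := by
  by_contra hne
  have hpos : 0 < a := lt_of_le_of_ne ha (Ne.symm hne)
  have hB : 0 < B := by have := h 1 one_pos le_rfl; linarith
  have h1 := h (min 1 (a / (2 * B))) (by positivity) (min_le_left _ _)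
  have h2 : min 1 (a / (2 * B)) * B ≤ a / (2 * B) * B := by gcongr; exact min_le_right _ _
  have h3 : a / (2 * B) * B = a / 2 := by field_simp
  linarith

/-- Mollification by an even kernel is symmetric. -/
theorem integral_smear_mul {κ G θ : E → ℝ} (hκ : Continuous κ) (hc : HasCompactSupport κ)
    (heven : ∀ x, κ (-x) = κ x) (hG : Integrable G μ) (hθ : Continuous θ)
    (hcθ : HasCompactSupport θ) :
    ∫ x, smear μ κ G x * θ x ∂μ = ∫ x, G x * smear μ κ θ x ∂μ := by
  obtain ⟨B, hB⟩ := hcθ.exists_bound_of_continuous hθ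
  have hi : Integrable (fun p : E × E => G p.2 * κ (p.1 - p.2)) (μ.prod μ) :=
    hG.convolution_integrand (ContinuousLinearMap.mul ℝ ℝ)
      (hκ.integrable_of_hasCompactSupport hc)
  have hi2 : Integrable (fun p : E × E => G p.2 * κ (p.1 - p.2) * θ p.1) (μ.prod μ) :=
    hi.mul_bdd (c := B) (hθ.comp continuous_fst).aestronglyMeasurable (ae_of_all _ fun p => hB p.1)
  calc ∫ x, smear μ κ G x * θ x ∂μ = ∫ x, ∫ y, G y * κ (x - y) * θ x ∂μ ∂μ := by
        refine integral_congr_ae (ae_of_all _ fun x => ?_)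
        dsimp only
        rw [smear_apply, ← integral_mul_const]
        refine integral_congr_ae (ae_of_all _ fun y => ?_)
        dsimp only
        ring
    _ = ∫ y, ∫ x, G y * κ (x - y) * θ x ∂μ ∂μ := integral_integral_swap hi2
    _ = ∫ y, G y * smear μ κ θ y ∂μ := by
        refine integral_congr_ae (ae_of_all _ fun y => ?_)
        dsimp only
        rw [smear_apply, ← integral_const_mul]
        refine integral_congr_ae (ae_of_all _ fun x => ?_)
        dsimp only
        rw [← heven (x - y), neg_sub]
        ring

namespace WeakSolution

/-- A square integrable weak solution of `L g = c` exists only for `c = 0`. -/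
theorem const_eq_zero (h : WeakSolution μ v H g c) : c = 0 := by
  obtain ⟨Z, hZ⟩ : ∃ Z, ∫ x, Real.exp (-(H x)) ∂μ = Z := ⟨_, rfl⟩
  obtain ⟨M, hM⟩ : ∃ M, ∫ x, g x ^ 2 * Real.exp (-(H x)) ∂μ = M := ⟨_, rfl⟩
  obtain ⟨m, hm'⟩ : ∃ m, ∫ x in Metric.closedBall (0 : E) 1, Real.exp (-(H x)) ∂μ = m := ⟨_, rfl⟩
  obtain ⟨n, hn⟩ : ∃ n, (Fintype.card ι : ℝ) = n := ⟨_, rfl⟩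
  have hm : 0 < m := by
    rw [← hm']
    refine (setIntegral_pos_iff_support_of_nonneg_ae (ae_of_all _ fun x => (Real.exp_pos _).le)
      h.integrable_weight.integrableOn).2 ?_
    have : Function.support (fun x => Real.exp (-(H x))) = Set.univ :=
      Set.eq_univ_of_forall fun x => (Real.exp_pos _).ne'
    rw [this, Set.univ_inter]
    exact Metric.measure_closedBall_pos μ _ one_pos
  -- The Caccioppoli bound for `κ₀ = η = 1`. It depends neither on `ε` nor on the cutoffs, which is
  -- what makes the limit `ε → 0` conclusive.
  obtain ⟨A, hA⟩ : ∃ A, 2 * (n * ((10 * 1 ^ 2 + 4 * 1 ^ 2) * M) + |c| * (Z + 2 * M)) = A :=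
    ⟨_, rfl⟩
  have main : |c| * (m / 2) = 0 := by
    refine eq_zero_of_forall_le_mul (B := n * (2 * Z + 2 * M) + A) (by positivity) fun ε hε _ => ?_
    -- `ψ` is the test function, with gradient at most `ε`; `χ` is 1 on its support, so the energy
    -- of the mollification there is at most `A`.
    obtain ⟨ψ, hψ, hcψ, hψ0, hψ1, hψr, hψd⟩ := exists_cutoff v 1 hε
    obtain ⟨r, hr⟩ := exists_tsupport_subset_closedBall hcψ
    obtain ⟨χ, hχ, hcχ, hχ0, hχ1, hχr, hχd⟩ := exists_cutoff v r one_pos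
    obtain ⟨s, hs⟩ := exists_tsupport_subset_closedBall hcχ
    obtain ⟨δ, hδ, hb⟩ := h.exists_mollifierBounds (max r s) one_pos
    obtain ⟨φ, hφ⟩ := exists_contDiffBump_rOut_lt (E := E) hδ
    have hbφ := hb φ hφ
    have cac := h.sum_integral_sq_le φ hχ hcχ hχ0 hχ1 hχd fun x hx =>
      hbφ x (Metric.closedBall_subset_closedBall (le_max_right _ _) (hs hx))
    rw [hZ, hM, hn, hA] at cac
    set κ := φ.normed μ
    set P := smear μ κ (fun y => g y ^ 2 * Real.exp (-(H y)))
    have hκ : ContDiff ℝ ∞ κ := φ.contDiff_normed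
    have κs : HasCompactSupport κ := φ.hasCompactSupport_normed
    have hP0 : ∀ x, 0 ≤ P x := smear_sq_nonneg φ
    have hPi : Integrable P μ := h.integrable_smear_sq φ
    have hPM : ∫ x, P x ∂μ = M := (h.integral_smear_sq φ).trans hM
    have key := h.sum_integral_flux_mul hκ κs (ψ := ψ) (hψ.of_le (by exact_mod_cast le_top)) hcψ
    have cp (b : ι) : Continuous (dirDeriv (v b) (regularized μ H g κ)) :=
      (contDiff_dirDeriv (m := 1) (h.contDiff_regularized hκ κs) (by norm_num) _).continuous
    have hcχ2 : HasCompactSupport fun x => χ x ^ 2 := hcχ.comp_left (g := fun t => t ^ 2) (by simp)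
    have i1 (b : ι) : Integrable (fun x => Real.exp (-(H x)) * χ x ^ 2 *
        dirDeriv (v b) (regularized μ H g κ) x ^ 2) μ :=
      ((h.continuous_weight.mul (hχ.continuous.pow 2)).mul
        ((cp b).pow 2)).integrable_of_hasCompactSupport
        (hcχ2.mul_left.mul_right)
    have up (b : ι) : ‖∫ x, (Real.exp (-(H x)) * dirDeriv (v b) (regularized μ H g κ) x +
        commutator μ H g κ (v b) x) * dirDeriv (v b) ψ x ∂μ‖ ≤
        ε * ((2 * Z + 2 * M) + ∫ x, Real.exp (-(H x)) * χ x ^ 2 *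
          dirDeriv (v b) (regularized μ H g κ) x ^ 2 ∂μ) := by
      have j1 : Integrable (fun x => 2 * Real.exp (-(H x)) + 2 * P x) μ :=
        (h.integrable_weight.const_mul 2).add (hPi.const_mul 2)
      have e : ε * ((2 * Z + 2 * M) + ∫ x, Real.exp (-(H x)) * χ x ^ 2 *
          dirDeriv (v b) (regularized μ H g κ) x ^ 2 ∂μ) =
          ∫ x, ε * ((2 * Real.exp (-(H x)) + 2 * P x) + Real.exp (-(H x)) * χ x ^ 2 *
          dirDeriv (v b) (regularized μ H g κ) x ^ 2) ∂μ := by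
        rw [integral_const_mul, integral_add j1 (i1 b), integral_add
          (h.integrable_weight.const_mul 2) (hPi.const_mul 2), integral_const_mul,
          integral_const_mul, hPM, hZ]
      rw [e]
      refine norm_integral_le_of_norm_le ((j1.add (i1 b)).const_mul ε) (ae_of_all _ fun x => ?_)
      have hw := Real.exp_pos (-(H x))
      set p := dirDeriv (v b) (regularized μ H g κ) x
      set R := commutator μ H g κ (v b) x
      by_cases hx : x ∈ tsupport ψ
      · have hR := (hbφ x (Metric.closedBall_subset_closedBall (le_max_left _ _) (hr hx))).comm b
        have hR' : |R| ≤ Real.exp (-(H x)) + 2 * P x := by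
          have := hP0 x
          refine abs_le_of_sq_le_sq ?_ (by positivity)
          refine hR.trans ?_
          change 2 * 1 ^ 2 * Real.exp (-(H x)) * P x ≤ _
          nlinarith [mul_nonneg hw.le this]
        have hp : Real.exp (-(H x)) * |p| ≤ Real.exp (-(H x)) + Real.exp (-(H x)) * p ^ 2 := by
          have : 0 ≤ Real.exp (-(H x)) * ((1 - |p|) ^ 2 + 1 + |p| ^ 2) := by positivity
          rw [← sq_abs p]
          nlinarith
        have h1 : |Real.exp (-(H x)) * p + R| ≤ Real.exp (-(H x)) * |p| + |R| := by
          refine (abs_add_le _ _).trans ?_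
          rw [abs_mul, abs_of_pos hw]
        rw [hχr x (hr hx), Real.norm_eq_abs, abs_mul, mul_comm]
        refine mul_le_mul (hψd b x) ?_ (abs_nonneg _) hε.le
        linarith
      · have h0 : dirDeriv (v b) ψ x = 0 :=
          image_eq_zero_of_notMem_tsupport (f := dirDeriv (v b) ψ)
            fun hx' => hx (tsupport_fderiv_apply_subset ℝ (v b) hx')
        have := hP0 x
        rw [h0]
        simp only [mul_zero, norm_zero]
        positivity
    -- The right side of the tested equation stays away from 0: `ψ = 1` on the unit ball, and there
    -- the mollified weight is at least half the weight.
    have low : m / 2 ≤ ∫ x, smear μ κ (fun y => Real.exp (-(H y))) x * ψ x ∂μ := by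
      rw [← hm', ← integral_div, ← integral_indicator Metric.isClosed_closedBall.measurableSet]
      have cI : Continuous (smear μ κ (fun y => Real.exp (-(H y)))) :=
        (contDiff_smear μ hκ κs h.integrable_weight.locallyIntegrable).continuous
      refine integral_mono ((h.integrable_weight.div_const 2).indicator
        Metric.isClosed_closedBall.measurableSet)
        ((cI.mul hψ.continuous).integrable_of_hasCompactSupport hcψ.mul_left) fun x => ?_
      by_cases hx : x ∈ tsupport ψ
      · have hI := (hbφ x (Metric.closedBall_subset_closedBall (le_max_left _ _) (hr hx))).lower
        have hw := Real.exp_pos (-(H x))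
        by_cases hx1 : x ∈ Metric.closedBall (0 : E) 1
        · simp only [Set.indicator_of_mem hx1, hψr x hx1]
          linarith
        · simp only [Set.indicator_of_notMem hx1]
          exact mul_nonneg (by linarith) (hψ0 x)
      · have hx1 : x ∉ Metric.closedBall (0 : E) 1 := fun hx1 => by
          have h1 := hψr x hx1
          rw [image_eq_zero_of_notMem_tsupport hx] at h1
          exact zero_ne_one h1
        simp only [Set.indicator_of_notMem hx1, image_eq_zero_of_notMem_tsupport hx, mul_zero,
          le_refl]
    calc |c| * (m / 2) ≤ |c| * ∫ x, smear μ κ (fun y => Real.exp (-(H y))) x * ψ x ∂μ :=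
          mul_le_mul_of_nonneg_left low (abs_nonneg c)
      _ ≤ |c * ∫ x, smear μ κ (fun y => Real.exp (-(H y))) x * ψ x ∂μ| := by
          rw [abs_mul]
          exact mul_le_mul_of_nonneg_left (le_abs_self _) (abs_nonneg c)
      _ ≤ ∑ b, ε * ((2 * Z + 2 * M) + ∫ x, Real.exp (-(H x)) * χ x ^ 2 *
          dirDeriv (v b) (regularized μ H g κ) x ^ 2 ∂μ) := by
          rw [← key]
          exact (Finset.abs_sum_le_sum_abs _ _).trans (Finset.sum_le_sum fun b _ => up b)
      _ ≤ ε * (n * (2 * Z + 2 * M) + A) := by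
          rw [← Finset.mul_sum, Finset.sum_add_distrib, Finset.sum_const, Finset.card_univ,
            nsmul_eq_mul, hn]
          exact mul_le_mul_of_nonneg_left (by linarith) hε.le
  rcases mul_eq_zero.1 main with h1 | h1
  · exact abs_eq_zero.1 h1
  · linarith

theorem locallyIntegrable (h : WeakSolution μ v H g c) : LocallyIntegrable g μ := by
  have := h.locallyIntegrable_density_mul (q := fun x => Real.exp (H x))
    h.contDiff.continuous.rexp
  refine this.congr (ae_of_all _ fun x => ?_)
  dsimp only
  rw [mul_assoc, ← Real.exp_add]
  simp

/-- The distributional gradient of a weak solution vanishes. -/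
theorem integral_mul_dirDeriv_eq_zero (h : WeakSolution μ v H g c) {ψ : E → ℝ}
    (hψ : ContDiff ℝ ∞ ψ) (hcψ : HasCompactSupport ψ) (b : ι) :
    ∫ x, g x * dirDeriv (v b) ψ x ∂μ = 0 := by
  obtain rfl := h.const_eq_zero
  obtain ⟨M, hM⟩ : ∃ M, ∫ x, g x ^ 2 * Real.exp (-(H x)) ∂μ = M := ⟨_, rfl⟩
  obtain ⟨n, hn⟩ : ∃ n, (Fintype.card ι : ℝ) = n := ⟨_, rfl⟩
  set G : E → ℝ := fun y => g y * Real.exp (-(H y))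
  -- With this `θ`, pairing `g` with `∂_b ψ` is pairing the integrable density `G` with a continuous
  -- compactly supported function.
  set θ : E → ℝ := fun x => Real.exp (H x) * dirDeriv (v b) ψ x
  have cdψ : Continuous (dirDeriv (v b) ψ) :=
    (contDiff_dirDeriv (m := 0) hψ (by simp) _).continuous
  have hθ : Continuous θ := h.contDiff.continuous.rexp.mul cdψ
  have hcθ : HasCompactSupport θ := (hasCompactSupport_dirDeriv hcψ _).mul_left
  have hgθ : ∫ x, g x * dirDeriv (v b) ψ x ∂μ = ∫ x, G x * θ x ∂μ := by
    refine integral_congr_ae (ae_of_all _ fun x => ?_)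
    have hE : Real.exp (-(H x)) * Real.exp (H x) = 1 := by rw [← Real.exp_add]; simp
    simp only [G, θ]
    linear_combination -(g x * dirDeriv (v b) ψ x) * hE
  have hcψ2 : HasCompactSupport fun x => ψ x ^ 2 := hcψ.comp_left (g := fun t => t ^ 2) (by simp)
  have iψ : Integrable (fun x => ψ x ^ 2 * Real.exp (H x)) μ :=
    ((hψ.continuous.pow 2).mul h.contDiff.continuous.rexp).integrable_of_hasCompactSupport
      hcψ2.mul_right
  refine abs_eq_zero.1 (eq_zero_of_forall_le_mul (B := 28 * n * M +
    (∫ x, ψ x ^ 2 * Real.exp (H x) ∂μ) + ∫ x, ‖G x‖ ∂μ) (abs_nonneg _) fun ε hε _ => ?_)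
  obtain ⟨r, hr⟩ := exists_tsupport_subset_closedBall hcψ
  obtain ⟨χ, hχ, hcχ, hχ0, hχ1, hχr, hχd⟩ := exists_cutoff v r hε
  obtain ⟨s, hs⟩ := exists_tsupport_subset_closedBall hcχ
  obtain ⟨δ, hδ, hb⟩ := h.exists_mollifierBounds s hε
  obtain ⟨δ', hδ', hu⟩ := Metric.uniformContinuous_iff.1
    (hcθ.uniformContinuous_of_continuous hθ) ε hε
  obtain ⟨φ, hφ⟩ := exists_contDiffBump_rOut_lt (E := E) (lt_min hδ hδ')
  have cac := h.sum_integral_sq_le φ hχ hcχ hχ0 hχ1 hχd fun x hx =>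
    hb φ (hφ.trans_le (min_le_left _ _)) x (hs hx)
  rw [hM, hn] at cac
  set κ := φ.normed μ
  set γ := regularized μ H g κ
  have hκ : ContDiff ℝ ∞ κ := φ.contDiff_normed
  have κs : HasCompactSupport κ := φ.hasCompactSupport_normed
  have hγ : ContDiff ℝ 2 γ := h.contDiff_regularized hκ κs
  have cp (b : ι) : Continuous (dirDeriv (v b) γ) :=
    (contDiff_dirDeriv (m := 1) hγ (by norm_num) _).continuous
  have hcχ2 : HasCompactSupport fun x => χ x ^ 2 := hcχ.comp_left (g := fun t => t ^ 2) (by simp)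
  have i1 (b : ι) : Integrable (fun x => Real.exp (-(H x)) * χ x ^ 2 *
      dirDeriv (v b) γ x ^ 2) μ :=
    ((h.continuous_weight.mul (hχ.continuous.pow 2)).mul
      ((cp b).pow 2)).integrable_of_hasCompactSupport
      (hcχ2.mul_left.mul_right)
  -- Since `c = 0`, taking `κ₀ = η = ε` makes the Caccioppoli bound quadratic in `ε`: 28 = 2·(10 +
  -- 4).
  have cac' : ∫ x, Real.exp (-(H x)) * χ x ^ 2 * dirDeriv (v b) γ x ^ 2 ∂μ ≤
      28 * n * M * ε ^ 2 := by
    refine (Finset.single_le_sum (f := fun b => ∫ x, Real.exp (-(H x)) * χ x ^ 2 *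
      dirDeriv (v b) γ x ^ 2 ∂μ) (fun b _ => integral_nonneg fun x => by positivity)
      (Finset.mem_univ b)).trans (cac.trans (le_of_eq ?_))
    rw [abs_zero]
    ring
  have s1 : |∫ x, dirDeriv (v b) γ x * ψ x ∂μ| ≤
      ε * (28 * n * M + ∫ x, ψ x ^ 2 * Real.exp (H x) ∂μ) := by
    -- Young's inequality with weight `ε⁻¹` on the energy: the energy is of order `ε²`, so both
    -- terms are of order `ε`.
    have e1 : |∫ x, dirDeriv (v b) γ x * ψ x ∂μ| ≤
        ∫ x, (ε⁻¹ * (Real.exp (-(H x)) * χ x ^ 2 * dirDeriv (v b) γ x ^ 2) +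
          ε * (ψ x ^ 2 * Real.exp (H x))) ∂μ := by
      rw [← Real.norm_eq_abs]
      refine norm_integral_le_of_norm_le (((i1 b).const_mul _).add (iψ.const_mul _))
        (ae_of_all _ fun x => ?_)
      by_cases hx : x ∈ tsupport ψ
      · rw [hχr x (hr hx), Real.norm_eq_abs, abs_mul]
        set p := dirDeriv (v b) γ x
        set q := ψ x
        set a := Real.exp (H x / 2)
        have ha : 0 < a := Real.exp_pos _
        have ha2 : Real.exp (H x) = a * a := by rw [← Real.exp_add]; ring_nf
        rw [Real.exp_neg, ha2]
        have hnn : 0 ≤ ε⁻¹ * ((a⁻¹ * |p| - ε * (a * |q|)) ^ 2 / 1 + 2 * ε * (|p| * |q|)) -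
            (|p| * |q|) := by
          have : ε⁻¹ * (2 * ε * (|p| * |q|)) = 2 * (|p| * |q|) := by field_simp
          rw [mul_add, this]
          have := mul_nonneg (abs_nonneg p) (abs_nonneg q)
          have : 0 ≤ ε⁻¹ * ((a⁻¹ * |p| - ε * (a * |q|)) ^ 2 / 1) := by positivity
          linarith
        have e2 : ε⁻¹ * ((a⁻¹ * |p| - ε * (a * |q|)) ^ 2 / 1 + 2 * ε * (|p| * |q|)) =
            ε⁻¹ * ((a * a)⁻¹ * 1 ^ 2 * p ^ 2) + ε * (q ^ 2 * (a * a)) := by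
          rw [← sq_abs p, ← sq_abs q]
          field_simp
          ring
        linarith
      · rw [image_eq_zero_of_notMem_tsupport hx]
        simp only [mul_zero, norm_zero]
        positivity
    refine e1.trans ?_
    rw [integral_add ((i1 b).const_mul _) (iψ.const_mul _), integral_const_mul, integral_const_mul]
    have : ε⁻¹ * ∫ x, Real.exp (-(H x)) * χ x ^ 2 * dirDeriv (v b) γ x ^ 2 ∂μ ≤
        ε⁻¹ * (28 * n * M * ε ^ 2) := mul_le_mul_of_nonneg_left cac' (by positivity)
    have e3 : ε⁻¹ * (28 * n * M * ε ^ 2) = ε * (28 * n * M) := by field_simp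
    linarith
  have s2 : ∫ x, dirDeriv (v b) γ x * ψ x ∂μ = -∫ x, smear μ κ G x * θ x ∂μ := by
    rw [integral_dirDeriv_mul μ (hγ.of_le (by norm_num)) (hψ.of_le (by exact_mod_cast le_top)) hcψ]
    congr 1
    refine integral_congr_ae (ae_of_all _ fun x => ?_)
    simp only [γ, regularized, θ, G]
    ring
  -- Evenness of the kernel moves the mollification from `G` onto `θ`, which is uniformly
  -- continuous, hence changed by at most `ε`.
  have s3 : |(∫ x, G x * θ x ∂μ) - ∫ x, smear μ κ G x * θ x ∂μ| ≤ ε * ∫ x, ‖G x‖ ∂μ := by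
    have csθ : Continuous (smear μ κ θ) :=
      (contDiff_smear μ hκ κs hθ.locallyIntegrable).continuous
    obtain ⟨B, hB⟩ := hcθ.exists_bound_of_continuous hθ
    have hd : ∀ x, dist (smear μ κ θ x) (θ x) ≤ ε := fun x =>
      φ.dist_normed_convolution_le hθ.aestronglyMeasurable fun y hy =>
        (hu ((Metric.mem_ball.1 hy).trans (hφ.trans_le (min_le_right _ _)))).le
    have j1 : Integrable (fun x => G x * θ x) μ :=
      h.integrable_density.mul_bdd (c := B) hθ.aestronglyMeasurable (ae_of_all _ hB)
    have j2 : Integrable (fun x => G x * smear μ κ θ x) μ :=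
      h.integrable_density.mul_bdd (c := B + ε) csθ.aestronglyMeasurable (ae_of_all _ fun x => by
        have := hd x
        rw [dist_eq_norm] at this
        have h2 := norm_le_norm_add_norm_sub' (smear μ κ θ x) (θ x)
        linarith [hB x])
    rw [integral_smear_mul φ.continuous_normed κs φ.normed_neg h.integrable_density hθ hcθ,
      ← integral_sub j1 j2, ← integral_const_mul, ← Real.norm_eq_abs]
    refine norm_integral_le_of_norm_le (h.integrable_density.norm.const_mul ε)
      (ae_of_all _ fun x => ?_)
    rw [← mul_sub, norm_mul, mul_comm]
    refine mul_le_mul_of_nonneg_right ?_ (norm_nonneg _)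
    rw [← dist_eq_norm, dist_comm]
    exact hd x
  rw [hgθ]
  rw [s2, abs_neg] at s1
  calc |∫ x, G x * θ x ∂μ| = |((∫ x, G x * θ x ∂μ) - ∫ x, smear μ κ G x * θ x ∂μ) +
        ∫ x, smear μ κ G x * θ x ∂μ| := by ring_nf
    _ ≤ _ := abs_add_le _ _
    _ ≤ _ := by linarith

/-- A square integrable weak solution of `L g = c` is constant if the directions span. -/
theorem ae_eq_const (h : WeakSolution μ v H g c) (hv : Submodule.span ℝ (Set.range v) = ⊤) :
    ∃ a : ℝ, ∀ᵐ x ∂μ, g x = a := by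
  -- Shrinking kernels with outer radius twice the inner one; the bounded ratio is what Lebesgue
  -- differentiation requires.
  let φ : ℕ → ContDiffBump (0 : E) := fun n =>
    ⟨1 / ((n : ℝ) + 1), 2 * (1 / ((n : ℝ) + 1)), by positivity, by
      have : 0 < 1 / ((n : ℝ) + 1) := by positivity
      linarith⟩
  have hφ : Filter.Tendsto (fun n => (φ n).rOut) Filter.atTop (nhds 0) := by
    have := (tendsto_one_div_add_atTop_nhds_zero_nat (𝕜 := ℝ)).const_mul 2
    rwa [mul_zero] at this
  have hae := ContDiffBump.ae_convolution_tendsto_right_of_locallyIntegrable (μ := μ) (K := 2) hφ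
    (Filter.Eventually.of_forall fun n => le_rfl) h.locallyIntegrable
  have hconst (n : ℕ) (x : E) : smear μ ((φ n).normed μ) g x = smear μ ((φ n).normed μ) g 0 := by
    set κ := (φ n).normed μ
    have hκ : ContDiff ℝ ∞ κ := (φ n).contDiff_normed
    have κs : HasCompactSupport κ := (φ n).hasCompactSupport_normed
    have hκ1 : ContDiff ℝ 1 κ := hκ.of_le (by exact_mod_cast le_top)
    have cs : ContDiff ℝ 1 (smear μ κ g) := contDiff_smear μ (n := 1) hκ1 κs h.locallyIntegrable
    refine is_const_of_fderiv_eq_zero (𝕜 := ℝ) (cs.differentiable (by norm_num)) (fun y => ?_) x 0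
    -- The derivative of the mollification pairs `g` with the gradient of a translated kernel, which
    -- vanishes by the previous theorem.
    have hb : ∀ b, fderiv ℝ (smear μ κ g) y (v b) = 0 := by
      intro b
      have h1 := congrFun (dirDeriv_smear μ hκ1 κs h.locallyIntegrable (v b)) y
      rw [dirDeriv] at h1
      rw [h1, smear_apply]
      have hu : ContDiff ℝ ∞ fun z => κ (y - z) := hκ.comp (contDiff_const.sub contDiff_id)
      have hcu : HasCompactSupport fun z => κ (y - z) :=
        κs.comp_homeomorph (Homeomorph.subLeft y)
      have h2 := h.integral_mul_dirDeriv_eq_zero hu hcu b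
      have du : ∀ z, dirDeriv (v b) (fun z => κ (y - z)) z = -dirDeriv (v b) κ (y - z) := by
        intro z
        have k1 : HasFDerivAt κ (fderiv ℝ κ (y - z)) (y - z) :=
          (hκ.differentiable (by simp) _).hasFDerivAt
        have k2 : HasFDerivAt (fun z => y - z) (-(ContinuousLinearMap.id ℝ E)) z := by
          simpa using (hasFDerivAt_id (𝕜 := ℝ) z).const_sub y
        have k3 : HasFDerivAt (fun z => κ (y - z)) _ z := k1.comp z k2
        simp only [dirDeriv]
        rw [k3.fderiv]
        simp
      simp_rw [du, mul_neg, integral_neg, neg_eq_zero] at h2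
      simpa only [mul_comm] using h2
    ext z
    have hz : z ∈ Submodule.span ℝ (Set.range v) := hv ▸ Submodule.mem_top
    induction hz using Submodule.span_induction with
    | mem z hz => obtain ⟨b, rfl⟩ := hz; exact hb b
    | zero => simp
    | add z z' _ _ h1 h2 => simpa [h1] using h2
    | smul a z _ h1 => simp [h1]
  -- One point of convergence fixes the constant; if there is none, the almost everywhere statement
  -- is vacuous and any constant serves.
  by_cases hne : ∃ x, Filter.Tendsto (fun n => smear μ ((φ n).normed μ) g x) Filter.atTop (nhds (g x))
  · obtain ⟨x₀, hx₀⟩ := hne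
    refine ⟨g x₀, hae.mono fun x hx => ?_⟩
    refine tendsto_nhds_unique (f := fun n => smear μ ((φ n).normed μ) g x) hx ?_
    refine hx₀.congr fun n => ?_
    rw [hconst n x₀, hconst n x]
  · exact ⟨0, hae.mono fun x hx => absurd ⟨x, hx⟩ hne⟩

end WeakSolution

end Weak

/-! ### Density of the range of `L` and the passage to the Poincaré inequality. -/

section SpectralGap

variable {E : Type*} [NormedAddCommGroup E] [NormedSpace ℝ E] [FiniteDimensional ℝ E]
  [MeasurableSpace E] [BorelSpace E] {μ : Measure E} [μ.IsAddHaarMeasure]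
  {ι : Type*} [Fintype ι] {v : ι → E} {H : E → ℝ}

/-- The measure `e^{-H} dμ`. -/
noncomputable def boltzmann (μ : Measure E) (H : E → ℝ) : Measure E :=
  μ.withDensity fun x => ENNReal.ofReal (Real.exp (-(H x)))

theorem two_le_infty : (2 : WithTop ℕ∞) ≤ ∞ := WithTop.coe_le_coe.2 le_top

theorem measurable_boltzmann_density (hH : Continuous H) :
    Measurable fun x => ENNReal.ofReal (Real.exp (-(H x))) := by
  have : Continuous fun x => Real.exp (-(H x)) := hH.neg.rexp
  exact this.measurable.ennreal_ofReal

theorem integral_boltzmann (hH : Continuous H) (q : E → ℝ) :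
    ∫ x, q x ∂(boltzmann μ H) = ∫ x, q x * Real.exp (-(H x)) ∂μ := by
  rw [boltzmann, integral_withDensity_eq_integral_toReal_smul
    (measurable_boltzmann_density hH) (ae_of_all _ fun x => ENNReal.ofReal_lt_top)]
  refine integral_congr_ae (ae_of_all _ fun x => ?_)
  simp [ENNReal.toReal_ofReal (Real.exp_pos _).le, mul_comm]

theorem integrable_boltzmann_iff (hH : Continuous H) (q : E → ℝ) :
    Integrable q (boltzmann μ H) ↔ Integrable (fun x => q x * Real.exp (-(H x))) μ := by
  rw [boltzmann, integrable_withDensity_iff (measurable_boltzmann_density hH)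
    (ae_of_all _ fun x => ENNReal.ofReal_lt_top)]
  simp [ENNReal.toReal_ofReal (Real.exp_pos _).le]

theorem isFiniteMeasure_boltzmann (hw : Integrable (fun x => Real.exp (-(H x))) μ) :
    IsFiniteMeasure (boltzmann μ H) :=
  isFiniteMeasure_withDensity_ofReal hw.2

/-- The closure of `{L u}`, `u` a centred test function, is the space of all centred functions. -/
theorem exists_submodule_driftLaplacian (hH : ContDiff ℝ 2 H)
    (hw : Integrable (fun x => Real.exp (-(H x))) μ) (hv : Submodule.span ℝ (Set.range v) = ⊤) :
    ∃ K : Submodule ℝ (Lp ℝ 2 (boltzmann μ H)),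
      (∀ h ∈ K, ∃ u : E → ℝ, ContDiff ℝ ∞ u ∧ HasCompactSupport u ∧
        ∫ x, u x * Real.exp (-(H x)) ∂μ = 0 ∧ h =ᵐ[boltzmann μ H] driftLaplacian v H u) ∧
      ∀ F : Lp ℝ 2 (boltzmann μ H), ∫ x, F x ∂(boltzmann μ H) = 0 → F ∈ K.topologicalClosure := by
  have := isFiniteMeasure_boltzmann hw
  have hc := hH.continuous
  have two (u : E → ℝ) (hu : ContDiff ℝ ∞ u) : ContDiff ℝ 2 u := hu.of_le two_le_infty
  have iu (u : E → ℝ) (hu : ContDiff ℝ ∞ u) (hcu : HasCompactSupport u) :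
      Integrable (fun x => u x * Real.exp (-(H x))) μ :=
    (hu.continuous.mul hc.neg.rexp).integrable_of_hasCompactSupport hcu.mul_right
  have cL (u : E → ℝ) (hu : ContDiff ℝ ∞ u) : Continuous (driftLaplacian v H u) :=
    (contDiff_driftLaplacian (n := 0) (hH.of_le (by norm_num)) ((two u hu).of_le
      (by norm_num))).continuous
  have hLp (u : E → ℝ) (hu : ContDiff ℝ ∞ u) (hcu : HasCompactSupport u) :
      MemLp (driftLaplacian v H u) 2 (boltzmann μ H) :=
    (cL u hu).memLp_of_hasCompactSupport (hasCompactSupport_driftLaplacian hcu)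
  let K : Submodule ℝ (Lp ℝ 2 (boltzmann μ H)) :=
    { carrier := {h | ∃ u : E → ℝ, ContDiff ℝ ∞ u ∧ HasCompactSupport u ∧
        ∫ x, u x * Real.exp (-(H x)) ∂μ = 0 ∧ h =ᵐ[boltzmann μ H] driftLaplacian v H u}
      zero_mem' := by
        refine ⟨fun _ => 0, contDiff_const, HasCompactSupport.zero, by simp, ?_⟩
        have h0 : driftLaplacian v H (fun _ => (0 : ℝ)) = fun _ => 0 := by
          have := driftLaplacian_const_mul (v := v) (H := H) (f := fun _ : E => (0 : ℝ))
            contDiff_const 0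
          simpa using this
        rw [h0]
        exact Lp.coeFn_zero _ _ _
      add_mem' := by
        rintro h₁ h₂ ⟨u₁, a₁, b₁, c₁, d₁⟩ ⟨u₂, a₂, b₂, c₂, d₂⟩
        refine ⟨fun x => u₁ x + u₂ x, a₁.add a₂, b₁.add b₂, ?_, ?_⟩
        · simp_rw [add_mul]
          rw [integral_add (iu _ a₁ b₁) (iu _ a₂ b₂), c₁, c₂, add_zero]
        · rw [driftLaplacian_add (two _ a₁) (two _ a₂)]
          filter_upwards [Lp.coeFn_add h₁ h₂, d₁, d₂] with x e₁ e₂ e₃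
          rw [e₁, Pi.add_apply, e₂, e₃]
      smul_mem' := by
        rintro a h ⟨u, a₁, b₁, c₁, d₁⟩
        refine ⟨fun x => a * u x, contDiff_const.mul a₁, b₁.mul_left, ?_, ?_⟩
        · simp_rw [mul_assoc]
          rw [integral_const_mul, c₁, mul_zero]
        · rw [driftLaplacian_const_mul (two _ a₁)]
          filter_upwards [Lp.coeFn_smul a h, d₁] with x e₁ e₂
          rw [e₁, Pi.smul_apply, e₂, smul_eq_mul] }
  refine ⟨K, fun h hh => hh, fun F hF => ?_⟩
  rw [← Submodule.orthogonal_orthogonal_eq_closure, Submodule.mem_orthogonal]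
  intro g hg
  rw [Submodule.mem_orthogonal'] at hg
  have hweak : ∀ u : E → ℝ, ContDiff ℝ ∞ u → HasCompactSupport u →
      ∫ x, u x * Real.exp (-(H x)) ∂μ = 0 →
      ∫ x, g x * driftLaplacian v H u x * Real.exp (-(H x)) ∂μ = 0 := by
    intro u hu hcu hu0
    have h1 := hg ((hLp u hu hcu).toLp _) ⟨u, hu, hcu, hu0, (hLp u hu hcu).coeFn_toLp⟩
    rw [L2.inner_def, ← integral_boltzmann hc] at *
    rw [← h1]
    refine integral_congr_ae ?_
    filter_upwards [(hLp u hu hcu).coeFn_toLp] with x hx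
    simp [hx, mul_comm]
  -- Orthogonality is known only against `L u` with `u` centred, and constants are not compactly
  -- supported. A general `u` is centred by subtracting a multiple of this bump; the price is the
  -- constant `c = J / I`, which the Liouville theorem handles.
  let φ : ContDiffBump (0 : E) := ⟨1, 2, one_pos, one_lt_two⟩
  have hφ : ContDiff ℝ ∞ φ := φ.contDiff
  have hφ0 : 0 < ∫ x, φ x * Real.exp (-(H x)) ∂μ := by
    refine (integral_pos_iff_support_of_nonneg_ae (ae_of_all _ fun x =>
      mul_nonneg φ.nonneg (Real.exp_pos _).le) (iu _ hφ φ.hasCompactSupport)).2 ?_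
    have : Function.support (fun x => φ x * Real.exp (-(H x))) = Metric.ball 0 2 := by
      rw [← show Function.support φ = Metric.ball 0 2 from φ.support_eq]
      ext x
      simp [(Real.exp_pos _).ne']
    rw [this]
    exact Metric.measure_ball_pos μ _ two_pos
  set I := ∫ x, φ x * Real.exp (-(H x)) ∂μ with hI
  set J := ∫ x, g x * driftLaplacian v H φ x * Real.exp (-(H x)) ∂μ with hJ
  have hgL (u : E → ℝ) (hu : ContDiff ℝ ∞ u) (hcu : HasCompactSupport u) :
      Integrable (fun x => g x * driftLaplacian v H u x * Real.exp (-(H x))) μ := by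
    rw [← integrable_boltzmann_iff hc]
    exact (Lp.memLp g).integrable_mul (hLp u hu hcu)
  have hsol : WeakSolution μ v H g (J / I) :=
    { contDiff := hH
      integrable_weight := hw
      measurable := (Lp.stronglyMeasurable g).aestronglyMeasurable
      integrable_sq := by
        rw [← integrable_boltzmann_iff hc]
        exact (Lp.memLp g).integrable_sq
      weak := by
        intro u hu hcu
        set a := ∫ x, u x * Real.exp (-(H x)) ∂μ with ha
        have hφc : HasCompactSupport fun x => (-(a / I)) * φ x := φ.hasCompactSupport.mul_left
        have hφs : ContDiff ℝ ∞ fun x => (-(a / I)) * φ x := contDiff_const.mul hφ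
        have h1 := hweak (fun x => u x + (-(a / I)) * φ x) (hu.add hφs) (hcu.add hφc) (by
          simp_rw [add_mul]
          rw [integral_add (iu _ hu hcu) (iu _ hφs hφc)]
          simp_rw [mul_assoc]
          rw [integral_const_mul, ← hI, ← ha]
          field_simp
          ring)
        rw [driftLaplacian_add (two _ hu) (two _ hφs), driftLaplacian_const_mul (two _ hφ)] at h1
        have e : ∀ x, g x * (driftLaplacian v H u x + -(a / I) * driftLaplacian v H φ x) *
            Real.exp (-(H x)) = g x * driftLaplacian v H u x * Real.exp (-(H x)) +
            -(a / I) * (g x * driftLaplacian v H φ x * Real.exp (-(H x))) := fun x => by ring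
        simp_rw [e] at h1
        rw [integral_add (hgL _ hu hcu) ((hgL _ hφ φ.hasCompactSupport).const_mul _),
          integral_const_mul, ← hJ] at h1
        have : J / I * a = a / I * J := by ring
        linarith }
  obtain ⟨a, ha⟩ := hsol.ae_eq_const hv
  have ha' : ∀ᵐ x ∂(boltzmann μ H), g x = a := (withDensity_absolutelyContinuous μ _).ae_le ha
  rw [L2.inner_def]
  calc ∫ x, inner ℝ (g x) (F x) ∂(boltzmann μ H) = ∫ x, a * F x ∂(boltzmann μ H) := by
        refine integral_congr_ae ?_
        filter_upwards [ha'] with x hx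
        simp [hx, mul_comm]
    _ = 0 := by rw [integral_const_mul, hF, mul_zero]

/-- A bound `γ ∑_b ‖∂_b u‖² ≤ ‖L u‖²` on centred test functions implies the Poincaré inequality with
constant `γ` on centred test functions. -/
theorem poincare_of_le_driftLaplacian_sq (hH : ContDiff ℝ 2 H)
    (hw : Integrable (fun x => Real.exp (-(H x))) μ) (hv : Submodule.span ℝ (Set.range v) = ⊤)
    {γ : ℝ} (hγ : 0 < γ)
    (hgap : ∀ u : E → ℝ, ContDiff ℝ ∞ u → HasCompactSupport u →
      ∫ x, u x * Real.exp (-(H x)) ∂μ = 0 →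
      γ * ∑ b, ∫ x, dirDeriv (v b) u x ^ 2 * Real.exp (-(H x)) ∂μ ≤
        ∫ x, driftLaplacian v H u x ^ 2 * Real.exp (-(H x)) ∂μ)
    {f : E → ℝ} (hf : ContDiff ℝ ∞ f) (hcf : HasCompactSupport f)
    (hf0 : ∫ x, f x * Real.exp (-(H x)) ∂μ = 0) :
    γ * ∫ x, f x ^ 2 * Real.exp (-(H x)) ∂μ ≤
      ∑ b, ∫ x, dirDeriv (v b) f x ^ 2 * Real.exp (-(H x)) ∂μ := by
  have := isFiniteMeasure_boltzmann hw
  have hc := hH.continuous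
  obtain ⟨K, hK, hcl⟩ := exists_submodule_driftLaplacian hH hw hv
  have hfLp : MemLp f 2 (boltzmann μ H) := hf.continuous.memLp_of_hasCompactSupport hcf
  set F := hfLp.toLp f
  have hFf : F =ᵐ[boltzmann μ H] f := hfLp.coeFn_toLp
  have hFK : F ∈ K.topologicalClosure := by
    refine hcl F ?_
    rw [integral_congr_ae hFf, integral_boltzmann hc, hf0]
  set D := ∑ b, ∫ x, dirDeriv (v b) f x ^ 2 * Real.exp (-(H x)) ∂μ
  have id2 (u q : E → ℝ) (hu : ContDiff ℝ ∞ u) (hq : ContDiff ℝ ∞ q) (hcu : HasCompactSupport u)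
      (b : ι) :
      Integrable (fun x => dirDeriv (v b) u x * dirDeriv (v b) q x * Real.exp (-(H x))) μ := by
    have c1 : Continuous (dirDeriv (v b) u) :=
      (contDiff_dirDeriv (m := 0) hu (by simp) _).continuous
    have c2 : Continuous (dirDeriv (v b) q) :=
      (contDiff_dirDeriv (m := 0) hq (by simp) _).continuous
    refine ((c1.mul c2).mul hc.neg.rexp).integrable_of_hasCompactSupport ?_
    exact HasCompactSupport.mul_right (HasCompactSupport.mul_right
      (hasCompactSupport_dirDeriv hcu _))
  -- For `h = L u`, `⟨F, h⟩ = ∑_b ∫ ∂_b u ∂_b f e^{-H}`; Young's inequality with weight `γ` and the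
  -- hypothesis on `u` bound it. Only `h` remains, not `u`, so the inequality passes to the closure
  -- and may be read at `h = F`.
  have key : ∀ h ∈ K, 2 * inner ℝ F h ≤ D / γ + ‖h‖ ^ 2 := by
    intro h hh
    obtain ⟨u, hu, hcu, hu0, hhu⟩ := hK h hh
    have e1 : inner ℝ F h = ∑ b, ∫ x, dirDeriv (v b) u x * dirDeriv (v b) f x *
        Real.exp (-(H x)) ∂μ := by
      rw [← integral_mul_driftLaplacian μ (hH.of_le (by norm_num))
        (hu.of_le two_le_infty) (hf.of_le (by exact_mod_cast le_top)) hcf,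
        ← integral_boltzmann hc, L2.inner_def]
      refine integral_congr_ae ?_
      filter_upwards [hFf, hhu] with x h1 h2
      simp [h1, h2, mul_comm]
    have e2 : ‖h‖ ^ 2 = ∫ x, driftLaplacian v H u x ^ 2 * Real.exp (-(H x)) ∂μ := by
      rw [← real_inner_self_eq_norm_sq, L2.inner_def, ← integral_boltzmann hc]
      refine integral_congr_ae ?_
      filter_upwards [hhu] with x h2
      simp [h2, sq]
    have e3 (b : ι) : 2 * ∫ x, dirDeriv (v b) u x * dirDeriv (v b) f x * Real.exp (-(H x)) ∂μ ≤
        γ⁻¹ * (∫ x, dirDeriv (v b) f x ^ 2 * Real.exp (-(H x)) ∂μ) +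
          γ * ∫ x, dirDeriv (v b) u x ^ 2 * Real.exp (-(H x)) ∂μ := by
      have i1 := id2 u f hu hf hcu b
      have i2 := id2 f f hf hf hcf b
      have i3 := id2 u u hu hu hcu b
      simp_rw [← sq] at i2 i3
      rw [← integral_const_mul, ← integral_const_mul, ← integral_const_mul,
        ← integral_add (i2.const_mul _) (i3.const_mul _)]
      refine integral_mono (i1.const_mul _) ((i2.const_mul _).add (i3.const_mul _)) fun x => ?_
      have hE := Real.exp_pos (-(H x))
      have h1 : 0 ≤ γ⁻¹ * ((dirDeriv (v b) f x - γ * dirDeriv (v b) u x) ^ 2 *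
        Real.exp (-(H x))) := by positivity
      have h2 : γ⁻¹ * ((dirDeriv (v b) f x - γ * dirDeriv (v b) u x) ^ 2 * Real.exp (-(H x))) =
          γ⁻¹ * (dirDeriv (v b) f x ^ 2 * Real.exp (-(H x))) +
          γ * (dirDeriv (v b) u x ^ 2 * Real.exp (-(H x))) -
          2 * (dirDeriv (v b) u x * dirDeriv (v b) f x * Real.exp (-(H x))) := by
        field_simp
        ring
      dsimp only
      linarith
    have e4 := Finset.sum_le_sum fun b (_ : b ∈ Finset.univ) => e3 b
    rw [← Finset.mul_sum, Finset.sum_add_distrib, ← Finset.mul_sum, ← Finset.mul_sum, ← e1] at e4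
    have e5 := hgap u hu hcu hu0
    rw [← e2] at e5
    have e6 : γ⁻¹ * D = D / γ := by rw [div_eq_mul_inv, mul_comm]
    rw [← e6]
    linarith
  have hclosed : IsClosed {h : Lp ℝ 2 (boltzmann μ H) | 2 * inner ℝ F h ≤ D / γ + ‖h‖ ^ 2} :=
    isClosed_le (by fun_prop) (by fun_prop)
  have hF2 : 2 * inner ℝ F F ≤ D / γ + ‖F‖ ^ 2 :=
    closure_minimal (fun h hh => key h hh) hclosed hFK
  have hFF : ‖F‖ ^ 2 = ∫ x, f x ^ 2 * Real.exp (-(H x)) ∂μ := by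
    rw [← real_inner_self_eq_norm_sq, L2.inner_def, ← integral_boltzmann hc]
    refine integral_congr_ae ?_
    filter_upwards [hFf] with x h2
    simp [h2, sq]
  rw [real_inner_self_eq_norm_sq, hFF] at hF2
  have : (∫ x, f x ^ 2 * Real.exp (-(H x)) ∂μ) ≤ D / γ := by linarith
  rwa [le_div_iff₀ hγ, mul_comm] at this

end SpectralGap

/-! ### Difference operators on a finite abelian group. -/

section DiscreteLaplacian

variable {G : Type*} [AddCommGroup G] [Fintype G]

/-- The forward difference of `g` in the direction `a`. -/
def diff (a : G) (g : G → ℝ) (x : G) : ℝ := g (x + a) - g x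

/-- The adjoint of the forward difference. -/
def diffAdj (a : G) (g : G → ℝ) (x : G) : ℝ := g (x - a) - g x

theorem sum_diffAdj_mul (a : G) (g h : G → ℝ) :
    ∑ x, diffAdj a g x * h x = ∑ x, g x * diff a h x := by
  have : ∑ x, g (x - a) * h x = ∑ x, g x * h (x + a) := by
    rw [← Equiv.sum_comp (Equiv.addRight a) fun x => g (x - a) * h x]
    simp
  simp only [diffAdj, diff, sub_mul, mul_sub, Finset.sum_sub_distrib, this]

theorem diff_diffAdj_comm (a b : G) (g : G → ℝ) :
    diff a (diffAdj b g) = diffAdj b (diff a g) := by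
  funext x
  simp only [diff, diffAdj, add_sub_right_comm]
  ring

theorem diff_comm (a b : G) (g : G → ℝ) : diff a (diff b g) = diff b (diff a g) := by
  funext x
  simp only [diff, add_right_comm]
  ring

/-- Summation by parts, with all difference operators commuting. The cross terms of the squared
Laplacian are therefore sums of squares and may be dropped. -/
theorem sum_laplacian_mul_laplacian (a b : G) (g : G → ℝ) :
    ∑ x, diffAdj a (diff a g) x * diffAdj b (diff b g) x = ∑ x, diff a (diff b g) x ^ 2 := by
  rw [sum_diffAdj_mul, diff_diffAdj_comm]
  simp_rw [mul_comm (diff a g _)]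
  rw [sum_diffAdj_mul, diff_comm b a]
  simp_rw [sq]

theorem apply_add_nsmul_sub (a : G) (g : G → ℝ) (x : G) (n : ℕ) :
    g (x + n • a) - g x = ∑ j ∈ Finset.range n, diff a g (x + j • a) := by
  induction n with
  | zero => simp
  | succ n ih =>
    rw [Finset.sum_range_succ, ← ih, diff, succ_nsmul, add_assoc]
    ring

/-- Poincaré inequality on a cycle, for a function with vanishing sums over the cycle. -/
theorem sum_diff_sq_le (a : G) {N : ℕ} (hN : 0 < N) (ha : N • a = 0) (g : G → ℝ) :
    ∑ x, diff a g x ^ 2 ≤ (N : ℝ) ^ 2 * ∑ x, diff a (diff a g) x ^ 2 := by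
  have hN' : (0 : ℝ) < N := by exact_mod_cast hN
  set h := diff a g
  have habs (x : G) : |h x| ≤ ∑ l ∈ Finset.range N, |diff a h (x + l • a)| := by
    -- The increments of `g` around the cycle telescope to 0, so `h` has mean 0 along it and `|h x|`
    -- is at most the total variation of `h` on the cycle.
    have h0 : ∑ j ∈ Finset.range N, h (x + j • a) = 0 := by
      rw [← apply_add_nsmul_sub, ha, add_zero, sub_self]
    have h1 : (N : ℝ) * h x = -∑ j ∈ Finset.range N, (h (x + j • a) - h x) := by
      rw [Finset.sum_sub_distrib, h0]
      simp
    have h2 : ∀ j ∈ Finset.range N,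
        |h (x + j • a) - h x| ≤ ∑ l ∈ Finset.range N, |diff a h (x + l • a)| := by
      intro j hj
      rw [apply_add_nsmul_sub]
      refine (Finset.abs_sum_le_sum_abs _ _).trans
        (Finset.sum_le_sum_of_subset_of_nonneg ?_ fun _ _ _ => abs_nonneg _)
      exact Finset.range_subset_range.2 (Finset.mem_range.1 hj).le
    have h3 : (N : ℝ) * |h x| ≤ N * ∑ l ∈ Finset.range N, |diff a h (x + l • a)| := by
      calc (N : ℝ) * |h x| = |∑ j ∈ Finset.range N, (h (x + j • a) - h x)| := by
            have := congrArg abs h1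
            rwa [abs_neg, abs_mul, abs_of_pos hN'] at this
        _ ≤ ∑ j ∈ Finset.range N, |h (x + j • a) - h x| := Finset.abs_sum_le_sum_abs _ _
        _ ≤ ∑ _j ∈ Finset.range N, ∑ l ∈ Finset.range N, |diff a h (x + l • a)| :=
            Finset.sum_le_sum h2
        _ = _ := by simp
    exact le_of_mul_le_mul_left h3 hN'
  have hsq (x : G) : h x ^ 2 ≤ N * ∑ l ∈ Finset.range N, diff a h (x + l • a) ^ 2 := by
    have h1 : h x ^ 2 ≤ (∑ l ∈ Finset.range N, |diff a h (x + l • a)|) ^ 2 := by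
      rw [← sq_abs]
      exact pow_le_pow_left₀ (abs_nonneg _) (habs x) 2
    refine h1.trans ?_
    have := sq_sum_le_card_mul_sum_sq (s := Finset.range N)
      (f := fun l => |diff a h (x + l • a)|)
    simpa using this
  calc ∑ x, h x ^ 2 ≤ ∑ x, N * ∑ l ∈ Finset.range N, diff a h (x + l • a) ^ 2 :=
        Finset.sum_le_sum fun x _ => hsq x
    _ = N * ∑ l ∈ Finset.range N, ∑ x, diff a h (x + l • a) ^ 2 := by
        rw [← Finset.mul_sum, Finset.sum_comm]
    _ = N * ∑ _l ∈ Finset.range N, ∑ x, diff a h x ^ 2 := by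
        congr 1
        refine Finset.sum_congr rfl fun l _ => ?_
        exact Equiv.sum_comp (Equiv.addRight (l • a)) fun x => diff a h x ^ 2
    -- One factor `N` comes from Cauchy-Schwarz, the other from the `N` translates.
    _ = (N : ℝ) ^ 2 * ∑ x, diff a h x ^ 2 := by
        rw [Finset.sum_const, Finset.card_range, nsmul_eq_mul]
        ring

/-- The gap of the discrete Laplacian on gradients. -/
theorem sum_diff_sq_le_sum_laplacian_sq {κ : Type*} [Fintype κ] (a : κ → G) {N : ℕ} (hN : 0 < N)
    (ha : ∀ i, N • a i = 0) (g : G → ℝ) :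
    ∑ i, ∑ x, diff (a i) g x ^ 2 ≤
      (N : ℝ) ^ 2 * ∑ x, (∑ i, diffAdj (a i) (diff (a i) g) x) ^ 2 := by
  have h1 : ∑ x, (∑ i, diffAdj (a i) (diff (a i) g) x) ^ 2 =
      ∑ i, ∑ j, ∑ x, diff (a i) (diff (a j) g) x ^ 2 := by
    simp_rw [← sum_laplacian_mul_laplacian, sq, Finset.sum_mul_sum]
    rw [Finset.sum_comm]
    exact Finset.sum_congr rfl fun i _ => Finset.sum_comm
  rw [h1, Finset.mul_sum]
  -- Only the pure second differences `j = i` are kept.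
  refine Finset.sum_le_sum fun i _ => (sum_diff_sq_le (a i) hN (ha i) g).trans ?_
  refine mul_le_mul_of_nonneg_left ?_ (by positivity)
  exact Finset.single_le_sum (f := fun j => ∑ x, diff (a i) (diff (a j) g) x ^ 2)
    (fun j _ => Finset.sum_nonneg fun x _ => sq_nonneg _) (Finset.mem_univ i)

end DiscreteLaplacian

/-! ### Bond vectors of the torus. -/

section Torus

variable {d N : ℕ} [NeZero N]

theorem nsmul_single_one (i : Fin d) : N • (Pi.single i 1 : Torus d N) = 0 := by
  rw [← Pi.single_smul]
  simp

/-- Reversing a bond changes the sign of both factors, so orientations disappear from the product.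
-/
theorem bondVec_apply_mul (o : Orientation d N) (g : Torus d N → ℝ) (b : Bond d N) (x : Torus d N) :
    (g (head o b) - g (tail o b)) * bondVec o b x =
      diff (Pi.single b.2 1) g b.1 * ((if x = b.1 + Pi.single b.2 1 then 1 else 0) -
        if x = b.1 then 1 else 0) := by
  simp only [bondVec, head, tail, diff]
  cases o b
  · simp
    ring
  · simp

theorem sq_head_sub_tail (o : Orientation d N) (g : Torus d N → ℝ) (b : Bond d N) :
    (g (head o b) - g (tail o b)) ^ 2 = diff (Pi.single b.2 1) g b.1 ^ 2 := by
  simp only [head, tail, diff]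
  cases o b
  · simp
    ring
  · simp

theorem sum_mul_bondVec_apply (o : Orientation d N) (g : Torus d N → ℝ) (x : Torus d N) :
    ∑ b : Bond d N, (g (head o b) - g (tail o b)) * bondVec o b x =
      ∑ i, diffAdj (Pi.single i 1) (diff (Pi.single i 1) g) x := by
  simp_rw [bondVec_apply_mul]
  rw [Fintype.sum_prod_type_right]
  refine Finset.sum_congr rfl fun i _ => ?_
  simp only [mul_sub, Finset.sum_sub_distrib, diffAdj]
  congr 1
  · simp_rw [← sub_eq_iff_eq_add]
    simp
  · simp

/-- The gap of the discrete Laplacian of the torus, in terms of oriented bonds. -/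
theorem sum_sq_le_sum_sum_mul_bondVec (o : Orientation d N) (g : Torus d N → ℝ) :
    ∑ b : Bond d N, (g (head o b) - g (tail o b)) ^ 2 ≤
      (N : ℝ) ^ 2 * ∑ x, (∑ b : Bond d N, (g (head o b) - g (tail o b)) * bondVec o b x) ^ 2 := by
  simp_rw [sq_head_sub_tail, sum_mul_bondVec_apply]
  rw [Fintype.sum_prod_type_right]
  exact sum_diff_sq_le_sum_laplacian_sq _ (NeZero.pos N) nsmul_single_one g

theorem bondVec_mem_zeroSum (o : Orientation d N) (b : Bond d N) : bondVec o b ∈ zeroSum d N := by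
  change ∑ x, bondVec o b x = 0
  simp [bondVec, Finset.sum_sub_distrib]

/-- The vector of a bond, as an element of the space of zero-sum vectors. -/
noncomputable def bondTangent (o : Orientation d N) (b : Bond d N) : zeroSum d N :=
  ⟨bondVec o b, bondVec_mem_zeroSum o b⟩

/-- The periods of `g` form a subgroup containing the unit vectors, which generate the torus. -/
theorem apply_eq_apply_of_diff_eq_zero {g : Torus d N → ℝ}
    (hg : ∀ i x, diff (Pi.single i 1) g x = 0) (x y : Torus d N) : g x = g y := by
  let S : AddSubgroup (Torus d N) :=
    { carrier := {t | ∀ x, g (x + t) = g x}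
      zero_mem' := fun x => by rw [add_zero]
      add_mem' := fun {s t} hs ht x => by rw [← add_assoc, ht, hs]
      neg_mem' := fun {t} ht x => by
        have := ht (x + -t)
        rw [neg_add_cancel_right] at this
        exact this.symm }
  have h1 (i : Fin d) : (Pi.single i 1 : Torus d N) ∈ S := fun x => sub_eq_zero.1 (hg i x)
  have h2 (t : Torus d N) : t ∈ S := by
    rw [← Finset.univ_sum_single t]
    refine S.sum_mem fun i _ => ?_
    have : (Pi.single i (t i) : Torus d N) = (t i).val • Pi.single i 1 := by
      rw [← Pi.single_smul]
      simp
    rw [this]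
    exact S.nsmul_mem (h1 i) _
  have := h2 (y - x) x
  rw [add_sub_cancel] at this
  exact this.symm

/-- A vector orthogonal to every bond vector is constant on the torus, and a constant zero-sum
vector is 0. This is the nondegeneracy of `L` that the Liouville theorem needs. -/
theorem span_bondTangent (o : Orientation d N) :
    Submodule.span ℝ (Set.range (bondTangent o)) = ⊤ := by
  rw [← Submodule.orthogonal_eq_bot_iff, Submodule.eq_bot_iff]
  intro u hu
  rw [Submodule.mem_orthogonal] at hu
  have h1 (b : Bond d N) : (u : Config d N) (head o b) - (u : Config d N) (tail o b) = 0 := by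
    have := hu (bondTangent o b) (Submodule.subset_span ⟨b, rfl⟩)
    rw [Submodule.coe_inner] at this
    simpa [bondTangent, bondVec, inner_sub_left, EuclideanSpace.inner_single_left] using this
  have h2 : ∀ i x, diff (Pi.single i 1) (u : Config d N) x = 0 := by
    intro i x
    have := sq_head_sub_tail o (u : Config d N) (x, i)
    rw [h1] at this
    exact pow_eq_zero_iff (two_ne_zero) |>.1 (by simpa using this.symm)
  have h3 := apply_eq_apply_of_diff_eq_zero h2
  have h4 : ∑ x, (u : Config d N) x = 0 := u.2
  ext x
  have h5 : ∑ y, (u : Config d N) y = ∑ _y : Torus d N, (u : Config d N) x :=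
    Finset.sum_congr rfl fun y _ => h3 y x
  rw [h5, Finset.sum_const, Finset.card_univ, nsmul_eq_mul, mul_eq_zero] at h4
  rcases h4 with h4 | h4
  · exact absurd h4 (by exact_mod_cast Fintype.card_ne_zero)
  · simpa using h4

end Torus

/-! ### Transfer from the hyperplane to the linear space of zero-sum vectors. -/

section Transfer

variable {d N : ℕ} [NeZero N] {o : Orientation d N} {H f : Config d N → ℝ} {ρ : ℝ}

theorem contDiff_shift (ρ : ℝ) {n : WithTop ℕ∞} : ContDiff ℝ n (shift d N ρ) :=
  ((zeroSum d N).subtypeL.contDiff).add contDiff_const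

theorem isClosedEmbedding_shift (ρ : ℝ) : Topology.IsClosedEmbedding (shift d N ρ) := by
  refine Isometry.isClosedEmbedding fun v w => ?_
  simp [shift, edist_add_right, Subtype.edist_eq]

theorem contDiff_comp_shift {n : WithTop ℕ∞} (hf : ContDiff ℝ n f) (ρ : ℝ) :
    ContDiff ℝ n (f ∘ shift d N ρ) :=
  hf.comp (contDiff_shift ρ)

theorem dirDeriv_comp_shift (hf : Differentiable ℝ f) (o : Orientation d N) (b : Bond d N) (ρ : ℝ) :
    dirDeriv (bondTangent o b) (f ∘ shift d N ρ) = bondDeriv o b f ∘ shift d N ρ := by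
  funext v
  have h1 : HasFDerivAt (shift d N ρ) (zeroSum d N).subtypeL v :=
    (zeroSum d N).subtypeL.hasFDerivAt.add_const _
  have h2 := (hf (shift d N ρ v)).hasFDerivAt.comp v h1
  rw [dirDeriv, h2.fderiv]
  rfl

theorem contDiff_bondDeriv {n m : WithTop ℕ∞} (hf : ContDiff ℝ n f) (hmn : m + 1 ≤ n)
    (b : Bond d N) : ContDiff ℝ m (bondDeriv o b f) :=
  contDiff_dirDeriv hf hmn (bondVec o b)

theorem generator_comp_shift (hH : Differentiable ℝ H) (hf : ContDiff ℝ 2 f) :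
    generator o H f ∘ shift d N ρ =
      driftLaplacian (bondTangent o) (H ∘ shift d N ρ) (f ∘ shift d N ρ) := by
  funext v
  simp only [driftLaplacian, generator, Function.comp_apply]
  refine Finset.sum_congr rfl fun b _ => ?_
  rw [dirDeriv_comp_shift (hf.differentiable (by norm_num)), dirDeriv_comp_shift
    ((contDiff_bondDeriv (m := 1) hf (by norm_num) b).differentiable (by norm_num)),
    dirDeriv_comp_shift hH]
  rfl

/-- The first form of the Witten quadratic form: `∇̄f · 𝓛 ∇̄f`, split into its two parts. -/
theorem bondGrad_dotProduct_wittenLaplacian (η : Config d N) :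
    bondGrad o f η ⬝ᵥ wittenLaplacian o H (bondGrad o f) η =
      (∑ b, bondDeriv o b f η * generator o H (bondDeriv o b f) η) +
        ∑ b, ∑ c, bondDeriv o b f η * (bondDeriv o b (bondDeriv o c H) η * bondDeriv o c f η) := by
  simp only [dotProduct, wittenLaplacian, Matrix.mulVec, bondHess, Matrix.of_apply, bondGrad,
    mul_add, Finset.sum_add_distrib, Finset.mul_sum]

/-- The commutation relation on the hyperplane: `𝓛 ∇̄f = ∇̄(L f)`. -/
theorem bondGrad_dotProduct_wittenLaplacian_shift (hH : ContDiff ℝ 2 H) (hf : ContDiff ℝ ∞ f)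
    (v : zeroSum d N) :
    bondGrad o f (shift d N ρ v) ⬝ᵥ wittenLaplacian o H (bondGrad o f) (shift d N ρ v) =
      ∑ b, dirDeriv (bondTangent o b) (f ∘ shift d N ρ) v *
        dirDeriv (bondTangent o b)
          (driftLaplacian (bondTangent o) (H ∘ shift d N ρ) (f ∘ shift d N ρ)) v := by
  have hf3 : ContDiff ℝ 3 f := hf.of_le (WithTop.coe_le_coe.2 le_top)
  have hfb (b : Bond d N) : ContDiff ℝ 2 (bondDeriv o b f) := contDiff_bondDeriv hf3 (by norm_num) b
  have hHd : Differentiable ℝ H := hH.differentiable (by norm_num)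
  have hHb (b : Bond d N) : Differentiable ℝ (bondDeriv o b H) :=
    (contDiff_bondDeriv (m := 1) hH (by norm_num) b).differentiable (by norm_num)
  have hfd : Differentiable ℝ f := hf3.differentiable (by norm_num)
  rw [bondGrad_dotProduct_wittenLaplacian, ← Finset.sum_add_distrib]
  refine Finset.sum_congr rfl fun b _ => ?_
  rw [dirDeriv_driftLaplacian (contDiff_comp_shift hH ρ) (contDiff_comp_shift hf3 ρ),
    dirDeriv_comp_shift hfd, ← generator_comp_shift hHd (hfb b), mul_add, Finset.mul_sum]
  congr 1
  refine Finset.sum_congr rfl fun c _ => ?_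
  rw [dirDeriv_comp_shift hHd, dirDeriv_comp_shift (hHb c), dirDeriv_comp_shift hfd]
  rfl

/-- The inverse of the partition function. -/
noncomputable def invPartition (H : Config d N → ℝ) (ρ : ℝ) : ℝ :=
  (weightedMeasure H ρ Set.univ)⁻¹.toReal

theorem invPartition_nonneg : 0 ≤ invPartition H ρ := ENNReal.toReal_nonneg

theorem expect_eq (hH : Continuous H) (q : Config d N → ℝ) :
    expect H ρ q = invPartition H ρ *
      ∫ v : zeroSum d N, q (shift d N ρ v) * Real.exp (-((H ∘ shift d N ρ) v)) := by
  have hm : Measurable fun η => ENNReal.ofReal (Real.exp (-(H η))) := by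
    have : Continuous fun η => Real.exp (-(H η)) := hH.neg.rexp
    exact this.measurable.ennreal_ofReal
  rw [expect, canonicalMeasure, integral_smul_measure, smul_eq_mul, invPartition, weightedMeasure,
    integral_withDensity_eq_integral_toReal_smul hm (ae_of_all _ fun x => ENNReal.ofReal_lt_top),
    surfaceMeasure, (isClosedEmbedding_shift ρ).measurableEmbedding.integral_map]
  congr 1
  refine integral_congr_ae (ae_of_all _ fun v => ?_)
  simp [ENNReal.toReal_ofReal (Real.exp_pos _).le, mul_comm]

/-- An infinite mass would make the factor 0. Every test function with nonzero denominator thus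
brings the integrability of the weight with it. -/
theorem integrable_weight_of_invPartition_pos (hH : Continuous H) (h : 0 < invPartition H ρ) :
    Integrable fun v : zeroSum d N => Real.exp (-((H ∘ shift d N ρ) v)) := by
  have hw : Continuous fun η => Real.exp (-(H η)) := hH.neg.rexp
  have hfin : weightedMeasure H ρ Set.univ < ⊤ := by
    rw [lt_top_iff_ne_top]
    intro htop
    rw [invPartition, htop] at h
    simp at h
  rw [weightedMeasure, withDensity_apply _ MeasurableSet.univ, Measure.restrict_univ,
    surfaceMeasure, (isClosedEmbedding_shift ρ).measurableEmbedding.lintegral_map] at hfin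
  refine ⟨(hw.comp (contDiff_shift ρ (n := 0)).continuous).aestronglyMeasurable, ?_⟩
  rw [hasFiniteIntegral_iff_ofReal (ae_of_all _ fun v => (Real.exp_pos _).le)]
  exact hfin

theorem hasCompactSupport_comp_shift (hf : HasCompactSupport f) (ρ : ℝ) :
    HasCompactSupport (f ∘ shift d N ρ) :=
  hf.comp_isClosedEmbedding (isClosedEmbedding_shift ρ)

/-- Test functions on the hyperplane extend to test functions on the whole space. -/
theorem exists_extension {u : zeroSum d N → ℝ} (hu : ContDiff ℝ ∞ u) (hc : HasCompactSupport u)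
    (ρ : ℝ) : ∃ f : Config d N → ℝ, ContDiff ℝ ∞ f ∧ HasCompactSupport f ∧
      f ∘ shift d N ρ = u := by
  have hK : IsCompact (shift d N ρ '' tsupport u) :=
    hc.isCompact.image (contDiff_shift ρ (n := 0)).continuous
  obtain ⟨r, hr⟩ := hK.isBounded.subset_closedBall 0
  -- The maximum with 1 keeps the inner radius positive; `r` itself need not be.
  let φ : ContDiffBump (0 : Config d N) := ⟨max r 1, max r 1 + 1, by positivity, by linarith⟩
  have hproj (v : zeroSum d N) : (zeroSum d N).orthogonalProjectionOnto
      (shift d N ρ v - WithLp.toLp 2 fun _ => ρ) = v := by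
    rw [shift, add_sub_cancel_right]
    simp
  refine ⟨fun η => u ((zeroSum d N).orthogonalProjectionOnto (η - WithLp.toLp 2 fun _ => ρ)) * φ η,
    (hu.comp ((ContinuousLinearMap.contDiff _).comp (contDiff_id.sub contDiff_const))).mul
      φ.contDiff, φ.hasCompactSupport.mul_left, ?_⟩
  funext v
  simp only [Function.comp_apply, hproj]
  by_cases hv : v ∈ tsupport u
  · rw [φ.one_of_mem_closedBall, mul_one]
    exact Metric.closedBall_subset_closedBall (le_max_left _ _) (hr ⟨v, hv, rfl⟩)
  · rw [image_eq_zero_of_notMem_tsupport hv, zero_mul]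

end Transfer

/-! ### The Hessian of the Hamiltonian. -/

section Hamiltonian

variable {d N : ℕ} [NeZero N] {o : Orientation d N}

/-- The coefficients `p` and `q` make this class of functions stable under `bondDeriv`, so the same
formula yields the second derivatives. -/
theorem bondDeriv_sum_add_sum {φ ψ : ℝ → ℝ} (hφ : Differentiable ℝ φ) (hψ : Differentiable ℝ ψ)
    (p : Torus d N → ℝ) (q : Bond d N → ℝ) (b : Bond d N) :
    bondDeriv o b (fun η => (∑ x, p x * φ (η x)) +
      ∑ e : Bond d N, q e * ψ (η e.1 + η (e.1 + Pi.single e.2 1))) =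
      fun η => (∑ x, (p x * bondVec o b x) * deriv φ (η x)) +
        ∑ e : Bond d N, (q e * (bondVec o b e.1 + bondVec o b (e.1 + Pi.single e.2 1))) *
          deriv ψ (η e.1 + η (e.1 + Pi.single e.2 1)) := by
  funext η
  have h0 (x : Torus d N) : HasFDerivAt (fun η : Config d N => η x)
      (EuclideanSpace.proj x : Config d N →L[ℝ] ℝ) η :=
    (EuclideanSpace.proj x : Config d N →L[ℝ] ℝ).hasFDerivAt
  have h1 (x : Torus d N) := (((hφ (η x)).hasDerivAt.comp_hasFDerivAt η (h0 x)).const_mul (p x))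
  have h2 (e : Bond d N) := (((hψ (η e.1 + η (e.1 + Pi.single e.2 1))).hasDerivAt.comp_hasFDerivAt η
    ((h0 e.1).add (h0 (e.1 + Pi.single e.2 1)))).const_mul (q e))
  have h3 := (HasFDerivAt.fun_sum fun x (_ : x ∈ Finset.univ) => h1 x).add
    (HasFDerivAt.fun_sum fun e (_ : e ∈ Finset.univ) => h2 e)
  refine (congrArg (fun T : Config d N →L[ℝ] ℝ => T (bondVec o b)) h3.fderiv).trans ?_
  have h4 (x : Torus d N) :
      (EuclideanSpace.proj x : Config d N →L[ℝ] ℝ) (bondVec o b) = bondVec o b x := rfl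
  simp only [add_apply, sum_apply, smul_apply, smul_eq_mul, h4]
  congr 1
  · exact Finset.sum_congr rfl fun x _ => by ring
  · exact Finset.sum_congr rfl fun x _ => by ring

theorem contDiff_hamiltonian {V₁ V₂ : ℝ → ℝ} {n : WithTop ℕ∞} (h₁ : ContDiff ℝ n V₁)
    (h₂ : ContDiff ℝ n V₂) : ContDiff ℝ n (hamiltonian V₁ V₂ : Config d N → ℝ) := by
  have h0 (x : Torus d N) : ContDiff ℝ n (fun η : Config d N => η x) :=
    (EuclideanSpace.proj x : Config d N →L[ℝ] ℝ).contDiff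
  exact (ContDiff.sum fun x _ => h₁.comp (h0 x)).add
    (ContDiff.sum fun e _ => h₂.comp ((h0 _).add (h0 _)))

theorem bondDeriv_bondDeriv_hamiltonian {V₁ V₂ : ℝ → ℝ} (h₁ : ContDiff ℝ 2 V₁)
    (h₂ : ContDiff ℝ 2 V₂) (b c : Bond d N) (η : Config d N) :
    bondDeriv o b (bondDeriv o c (hamiltonian V₁ V₂)) η =
      (∑ x, bondVec o c x * bondVec o b x * deriv (deriv V₁) (η x)) +
        ∑ e : Bond d N, (bondVec o c e.1 + bondVec o c (e.1 + Pi.single e.2 1)) *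
          (bondVec o b e.1 + bondVec o b (e.1 + Pi.single e.2 1)) *
            deriv (deriv V₂) (η e.1 + η (e.1 + Pi.single e.2 1)) := by
  have e0 : (hamiltonian V₁ V₂ : Config d N → ℝ) = fun η => (∑ x, (1 : ℝ) * V₁ (η x)) +
      ∑ e : Bond d N, (1 : ℝ) * V₂ (η e.1 + η (e.1 + Pi.single e.2 1)) := by
    funext η
    simp [hamiltonian]
  have d1 : Differentiable ℝ (deriv V₁) :=
    (h₁.iterate_deriv' 1 1).differentiable (by norm_num)
  have d2 : Differentiable ℝ (deriv V₂) :=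
    (h₂.iterate_deriv' 1 1).differentiable (by norm_num)
  rw [e0, bondDeriv_sum_add_sum (h₁.differentiable (by norm_num))
    (h₂.differentiable (by norm_num)), bondDeriv_sum_add_sum d1 d2]
  simp only [one_mul]

/-- The Hessian is a weighted sum of rank-one matrices, so its quadratic form is a weighted sum of
squares. -/
theorem sum_sum_mul_sum {β τ : Type*} [Fintype β] [Fintype τ] (p : β → ℝ) (A : β → τ → ℝ)
    (a : τ → ℝ) :
    ∑ b, ∑ c, p b * ((∑ t, A c t * A b t * a t) * p c) = ∑ t, a t * (∑ b, p b * A b t) ^ 2 := by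
  simp_rw [sq, Finset.sum_mul_sum, Finset.sum_mul, Finset.mul_sum]
  rw [Finset.sum_comm' (t' := Finset.univ) (s' := fun _ => Finset.univ) (by simp)]
  simp_rw [Finset.sum_comm (s := Finset.univ (α := β)) (t := Finset.univ (α := τ))]
  exact Finset.sum_congr rfl fun t _ => Finset.sum_congr rfl fun b _ =>
    Finset.sum_congr rfl fun c _ => by ring

theorem deriv_deriv_nonneg_of_convexOn {V : ℝ → ℝ} (h : ContDiff ℝ 2 V)
    (hV : ConvexOn ℝ Set.univ V) (t : ℝ) : 0 ≤ deriv (deriv V) t := by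
  have hm : Monotone (deriv V) := by
    rw [← monotoneOn_univ]
    exact hV.monotoneOn_deriv fun x _ => h.differentiable (by norm_num) x
  exact hm.deriv_nonneg

/-- The Hessian of the Hamiltonian along the gradient of a function. -/
theorem hessian_lower_bound {V₁ V₂ : ℝ → ℝ} {C : ℝ} (h₁ : ContDiff ℝ 2 V₁) (h₂ : ContDiff ℝ 2 V₂)
    (hC : 0 ≤ C) (hV₁ : ∀ t, C ≤ deriv (deriv V₁) t) (hV₂ : ConvexOn ℝ Set.univ V₂)
    (f : Config d N → ℝ) (η : Config d N) :
    C / (N : ℝ) ^ 2 * ∑ b, bondDeriv o b f η ^ 2 ≤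
      ∑ b, ∑ c, bondDeriv o b f η *
        (bondDeriv o b (bondDeriv o c (hamiltonian V₁ V₂)) η * bondDeriv o c f η) := by
  set p : Bond d N → ℝ := fun b => bondDeriv o b f η with hp
  -- As `p` is the lattice gradient of `x ↦ ∂f/∂η_x` (see `hpg`), `W` is the positive lattice
  -- Laplacian of that function. This is where restricting to gradients matters.
  set W : Torus d N → ℝ := fun x => ∑ b, p b * bondVec o b x with hW
  have key : ∑ b, ∑ c, p b * (bondDeriv o b (bondDeriv o c (hamiltonian V₁ V₂)) η * p c) =
      (∑ x, deriv (deriv V₁) (η x) * W x ^ 2) +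
        ∑ e : Bond d N, deriv (deriv V₂) (η e.1 + η (e.1 + Pi.single e.2 1)) *
          (W e.1 + W (e.1 + Pi.single e.2 1)) ^ 2 := by
    simp_rw [bondDeriv_bondDeriv_hamiltonian h₁ h₂, add_mul (∑ _, _), mul_add (p _) (_ * _),
      Finset.sum_add_distrib]
    congr 1
    · exact sum_sum_mul_sum p _ _
    · refine (sum_sum_mul_sum p (fun b (e : Bond d N) =>
        bondVec o b e.1 + bondVec o b (e.1 + Pi.single e.2 1)) _).trans ?_
      simp only [hW, mul_add, Finset.sum_add_distrib]
  have hW1 : ∑ b, p b ^ 2 ≤ (N : ℝ) ^ 2 * ∑ x, W x ^ 2 := by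
    have hpg (b : Bond d N) : p b = fderiv ℝ f η (EuclideanSpace.single (head o b) 1) -
        fderiv ℝ f η (EuclideanSpace.single (tail o b) 1) := by
      simp [hp, bondDeriv, bondVec]
    have := sum_sq_le_sum_sum_mul_bondVec o
      fun x => fderiv ℝ f η (EuclideanSpace.single x (1 : ℝ))
    simpa only [hW, hpg] using this
  change C / (N : ℝ) ^ 2 * ∑ b, p b ^ 2 ≤
    ∑ b, ∑ c, p b * (bondDeriv o b (bondDeriv o c (hamiltonian V₁ V₂)) η * p c)
  rw [key]
  have hN : (0 : ℝ) < (N : ℝ) ^ 2 := by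
    have : (0 : ℝ) < N := by exact_mod_cast NeZero.pos N
    positivity
  calc C / (N : ℝ) ^ 2 * ∑ b, p b ^ 2 ≤ C / (N : ℝ) ^ 2 * ((N : ℝ) ^ 2 * ∑ x, W x ^ 2) := by gcongr
    _ = ∑ x, C * W x ^ 2 := by rw [← Finset.mul_sum]; rw [← mul_assoc, div_mul_cancel₀ _ hN.ne']
    _ ≤ ∑ x, deriv (deriv V₁) (η x) * W x ^ 2 := by gcongr with x; exact hV₁ _
    _ ≤ _ := le_add_of_nonneg_right (Finset.sum_nonneg fun e _ =>
        mul_nonneg (deriv_deriv_nonneg_of_convexOn h₂ hV₂ _) (sq_nonneg _))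

end Hamiltonian

/-! ### The two inequalities between the gaps. -/

section Gaps

variable {d N : ℕ} [NeZero N] {o : Orientation d N} {H f : Config d N → ℝ} {ρ : ℝ}

theorem integrable_mul_weight {E : Type*} [NormedAddCommGroup E] [MeasurableSpace E] [BorelSpace E]
    {μ : Measure E} [IsFiniteMeasureOnCompacts μ] {K q : E → ℝ} (hK : Continuous K)
    (hq : Continuous q) (hc : HasCompactSupport q) :
    Integrable (fun x => q x * Real.exp (-(K x))) μ :=
  (hq.mul hK.neg.rexp).integrable_of_hasCompactSupport hc.mul_right

theorem hasCompactSupport_bondDeriv (hf : HasCompactSupport f) (b : Bond d N) :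
    HasCompactSupport (bondDeriv o b f) :=
  hasCompactSupport_dirDeriv hf (bondVec o b)

theorem expect_bondGrad_sq (hH : ContDiff ℝ 2 H) (hf : ContDiff ℝ ∞ f) (hc : HasCompactSupport f) :
    expect H ρ (fun η => bondGrad o f η ⬝ᵥ bondGrad o f η) = invPartition H ρ *
      ∑ b, ∫ v, dirDeriv (bondTangent o b) (f ∘ shift d N ρ) v ^ 2 *
        Real.exp (-((H ∘ shift d N ρ) v)) := by
  rw [expect_eq hH.continuous, ← integral_finsetSum]
  · congr 1
    refine integral_congr_ae (ae_of_all _ fun v => ?_)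
    simp only [dotProduct, bondGrad, Finset.sum_mul,
      dirDeriv_comp_shift (hf.differentiable (by simp)), Function.comp_apply, sq]
  · intro b _
    have hf' := contDiff_comp_shift hf ρ
    have h1 : Continuous (dirDeriv (bondTangent o b) (f ∘ shift d N ρ)) :=
      (contDiff_dirDeriv (m := 0) hf' (by simp) _).continuous
    have h2 := hasCompactSupport_dirDeriv (hasCompactSupport_comp_shift hc ρ) (bondTangent o b)
    exact integrable_mul_weight (contDiff_comp_shift hH ρ).continuous (h1.pow 2)
      (h2.comp_left (g := fun t => t ^ 2) (by simp))

/-- The symmetry of `L` with `L u` itself as test function; `L u` is C¹ because `H` is C². -/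
theorem integral_driftLaplacian_sq {E ι : Type*} [NormedAddCommGroup E] [NormedSpace ℝ E]
    [FiniteDimensional ℝ E] [MeasurableSpace E] [BorelSpace E] (μ : Measure E) [μ.IsAddHaarMeasure]
    [Fintype ι] {v : ι → E} {K u : E → ℝ} (hK : ContDiff ℝ 2 K) (hu : ContDiff ℝ ∞ u)
    (hc : HasCompactSupport u) :
    ∫ x, driftLaplacian v K u x ^ 2 * Real.exp (-(K x)) ∂μ =
      ∑ b, ∫ x, dirDeriv (v b) u x * dirDeriv (v b) (driftLaplacian v K u) x *
        Real.exp (-(K x)) ∂μ := by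
  rw [← integral_mul_driftLaplacian μ (hK.of_le (by norm_num)) (hu.of_le two_le_infty)
    (contDiff_driftLaplacian (n := 1) (hK.of_le (by norm_num))
      (hu.of_le (WithTop.coe_le_coe.2 le_top))) (hasCompactSupport_driftLaplacian hc)]
  simp_rw [sq]

theorem expect_wittenLaplacian (hH : ContDiff ℝ 2 H) (hf : ContDiff ℝ ∞ f)
    (hc : HasCompactSupport f) :
    expect H ρ (fun η => bondGrad o f η ⬝ᵥ wittenLaplacian o H (bondGrad o f) η) =
      invPartition H ρ * ∫ v, driftLaplacian (bondTangent o) (H ∘ shift d N ρ)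
        (f ∘ shift d N ρ) v ^ 2 * Real.exp (-((H ∘ shift d N ρ) v)) := by
  have hf' := contDiff_comp_shift hf ρ
  have hH' := contDiff_comp_shift hH ρ
  have hc' := hasCompactSupport_comp_shift hc ρ
  rw [expect_eq hH.continuous, integral_driftLaplacian_sq _ hH' hf' hc', ← integral_finsetSum]
  · congr 1
    refine integral_congr_ae (ae_of_all _ fun v => ?_)
    simp only [bondGrad_dotProduct_wittenLaplacian_shift hH hf, Finset.sum_mul]
  · intro b _
    have h1 : Continuous (dirDeriv (bondTangent o b) (f ∘ shift d N ρ)) :=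
      (contDiff_dirDeriv (m := 0) hf' (by simp) _).continuous
    have h2 : Continuous (dirDeriv (bondTangent o b) (driftLaplacian (bondTangent o)
        (H ∘ shift d N ρ) (f ∘ shift d N ρ))) :=
      (contDiff_dirDeriv (m := 0) (n := 1) (contDiff_driftLaplacian (hH'.of_le (by norm_num))
        (hf'.of_le (WithTop.coe_le_coe.2 le_top))) (by simp) _).continuous
    exact integrable_mul_weight hH'.continuous (h1.mul h2)
      (hasCompactSupport_dirDeriv hc' _).mul_right

theorem dirichletForm_self (hH : ContDiff ℝ 2 H) (hf : ContDiff ℝ ∞ f) (hc : HasCompactSupport f) :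
    dirichletForm o H ρ f f = invPartition H ρ *
      ∑ b, ∫ v, dirDeriv (bondTangent o b) (f ∘ shift d N ρ) v ^ 2 *
        Real.exp (-((H ∘ shift d N ρ) v)) := by
  have hf' := contDiff_comp_shift hf ρ
  have hH' := contDiff_comp_shift hH ρ
  have hc' := hasCompactSupport_comp_shift hc ρ
  have key := integral_mul_driftLaplacian volume (v := bondTangent o) (hH'.of_le (by norm_num))
    (hf'.of_le two_le_infty) (hf'.of_le (WithTop.coe_le_coe.2 le_top)) hc'
  simp_rw [← sq] at key
  rw [dirichletForm, expect_eq hH.continuous, ← key,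
    ← generator_comp_shift (hH.differentiable (by norm_num)) (hf.of_le two_le_infty)]
  rfl

theorem correlation_self (hH : Continuous H) (hf : expect H ρ f = 0) :
    correlation H ρ f f = invPartition H ρ *
      ∫ v, (f ∘ shift d N ρ) v ^ 2 * Real.exp (-((H ∘ shift d N ρ) v)) := by
  rw [correlation, hf, expect_eq hH]
  simp_rw [sub_zero, sq]
  rfl

/-- The gap of the Witten Laplacian on gradients is a lower bound for the spectral gap. -/
theorem wittenGap_le_spectralGap (hH : ContDiff ℝ 2 H) :
    wittenGap o H ρ ≤ spectralGap o H ρ := by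
  refine le_iInf fun f => le_iInf fun hf => le_iInf fun hne => ?_
  have hf' := contDiff_comp_shift hf.smooth ρ
  have hH' := contDiff_comp_shift hH ρ
  have hc' := hasCompactSupport_comp_shift hf.compact ρ
  rw [correlation_self hH.continuous hf.centered] at hne ⊢
  rw [dirichletForm_self hH hf.smooth hf.compact]
  have hpos : 0 < invPartition H ρ :=
    lt_of_le_of_ne invPartition_nonneg (Ne.symm (left_ne_zero_of_mul hne))
  have hw := integrable_weight_of_invPartition_pos hH.continuous hpos
  rw [mul_div_mul_left _ _ hpos.ne']
  set D := ∑ b, ∫ v, dirDeriv (bondTangent o b) (f ∘ shift d N ρ) v ^ 2 *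
        Real.exp (-((H ∘ shift d N ρ) v))
  set V := ∫ v, (f ∘ shift d N ρ) v ^ 2 * Real.exp (-((H ∘ shift d N ρ) v))
  have hD : 0 ≤ D := Finset.sum_nonneg fun b _ => integral_nonneg fun v => by positivity
  have hV : 0 < V :=
    lt_of_le_of_ne (integral_nonneg fun v => by positivity) (Ne.symm (right_ne_zero_of_mul hne))
  -- A real `γ` strictly between the quotient and the Witten gap also covers an infinite Witten gap.
  by_contra hlt
  rw [not_le] at hlt
  obtain ⟨γ, hγ1, hγ2⟩ := EReal.lt_iff_exists_real_btwn.1 hlt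
  rw [EReal.coe_lt_coe_iff] at hγ1
  have hγ : 0 < γ := (div_nonneg hD hV.le).trans_lt hγ1
  have hf0 : ∫ v, (f ∘ shift d N ρ) v * Real.exp (-((H ∘ shift d N ρ) v)) = 0 := by
    have := hf.centered
    rw [expect_eq hH.continuous] at this
    exact (mul_eq_zero.1 this).resolve_left hpos.ne'
  have hgap := poincare_of_le_driftLaplacian_sq (μ := volume) hH' hw (span_bondTangent o) hγ
    (fun u hu hcu hu0 => ?_) hf' hc' hf0
  · rw [div_lt_iff₀ hV] at hγ1
    exact absurd hgap (not_le.2 hγ1)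
  · obtain ⟨q, hq, hcq, rfl⟩ := exists_extension hu hcu ρ
    have hq0 : IsCenteredTest H ρ q := ⟨hq, hcq, by
      rw [expect_eq hH.continuous]
      exact mul_eq_zero_of_right _ hu0⟩
    set A := ∑ b, ∫ v, dirDeriv (bondTangent o b) (q ∘ shift d N ρ) v ^ 2 *
      Real.exp (-((H ∘ shift d N ρ) v)) with hA
    set B := ∫ v, driftLaplacian (bondTangent o) (H ∘ shift d N ρ)
        (q ∘ shift d N ρ) v ^ 2 * Real.exp (-((H ∘ shift d N ρ) v)) with hB
    have hA0 : 0 ≤ A := Finset.sum_nonneg fun b _ => integral_nonneg fun v => by positivity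
    have hB0 : 0 ≤ B := integral_nonneg fun v => by positivity
    -- Functions with zero gradient are excluded from the infimum, but the required inequality is
    -- trivial for them.
    rcases hA0.eq_or_lt with hA1 | hA1
    · rw [← hA1, mul_zero]
      exact hB0
    · have h1 := expect_bondGrad_sq (o := o) (ρ := ρ) hH hq hcq
      have h2 := expect_wittenLaplacian (o := o) (ρ := ρ) hH hq hcq
      have h3 : wittenGap o H ρ ≤ ((B / A : ℝ) : EReal) := by
        have hne' : expect H ρ (fun η => bondGrad o q η ⬝ᵥ bondGrad o q η) ≠ 0 := by
          rw [h1]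
          exact (mul_pos hpos hA1).ne'
        have h4 : wittenGap o H ρ ≤ ((expect H ρ (fun η => bondGrad o q η ⬝ᵥ
            wittenLaplacian o H (bondGrad o q) η) /
            expect H ρ (fun η => bondGrad o q η ⬝ᵥ bondGrad o q η) : ℝ) : EReal) :=
          (iInf_le _ q).trans ((iInf_le _ hq0).trans (iInf_le _ hne'))
        rw [h1, h2, mul_div_mul_left _ _ hpos.ne'] at h4
        exact h4
      have h5 := hγ2.trans_le h3
      rw [EReal.coe_lt_coe_iff, lt_div_iff₀ hA1] at h5
      exact h5.le

/-- The lower bound for the gap of the Witten Laplacian on gradients. -/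
theorem le_wittenGap {V₁ V₂ : ℝ → ℝ} {C : ℝ} (h₁ : ContDiff ℝ 2 V₁) (h₂ : ContDiff ℝ 2 V₂)
    (hC : 0 ≤ C) (hV₁ : ∀ t, C ≤ deriv (deriv V₁) t) (hV₂ : ConvexOn ℝ Set.univ V₂) :
    ((C / (N : ℝ) ^ 2 : ℝ) : EReal) ≤ wittenGap o (hamiltonian V₁ V₂) ρ := by
  refine le_iInf fun f => le_iInf fun hf => le_iInf fun hne => ?_
  rw [EReal.coe_le_coe_iff]
  set H : Config d N → ℝ := hamiltonian V₁ V₂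
  have hH : ContDiff ℝ 2 H := contDiff_hamiltonian h₁ h₂
  have hH' := contDiff_comp_shift hH ρ
  have hf3 : ContDiff ℝ 3 f := hf.smooth.of_le (WithTop.coe_le_coe.2 le_top)
  have hfb (b : Bond d N) : ContDiff ℝ 2 (bondDeriv o b f) := contDiff_bondDeriv hf3 (by norm_num) b
  have hcb (b : Bond d N) := hasCompactSupport_bondDeriv (o := o) hf.compact b
  have hHb (b c : Bond d N) : Continuous (bondDeriv o b (bondDeriv o c H)) :=
    (contDiff_bondDeriv (m := 0) (contDiff_bondDeriv (m := 1) hH (by norm_num) c)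
      (by norm_num) b).continuous
  have hs := (contDiff_shift (d := d) (N := N) ρ (n := 0)).continuous
  set w : zeroSum d N → ℝ := fun v => Real.exp (-((H ∘ shift d N ρ) v)) with hw
  have hint {q : Config d N → ℝ} (hq : Continuous q) (hcq : HasCompactSupport q) :
      Integrable (fun v => q (shift d N ρ v) * w v) :=
    integrable_mul_weight hH'.continuous (hq.comp hs) (hasCompactSupport_comp_shift hcq ρ)
  have hsq (b : Bond d N) : HasCompactSupport fun η => bondDeriv o b f η ^ 2 :=
    (hcb b).comp_left (g := fun t => t ^ 2) (by simp)
  have i1 : Integrable fun v => (∑ b, bondDeriv o b f (shift d N ρ v) ^ 2) * w v := by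
    simp_rw [Finset.sum_mul]
    exact integrable_finsetSum _ fun b _ => hint ((hfb b).continuous.pow 2) (hsq b)
  have hgen (b : Bond d N) : ∀ v, bondDeriv o b f (shift d N ρ v) *
      generator o H (bondDeriv o b f) (shift d N ρ v) * w v =
      (bondDeriv o b f ∘ shift d N ρ) v * driftLaplacian (bondTangent o) (H ∘ shift d N ρ)
        (bondDeriv o b f ∘ shift d N ρ) v * w v := by
    intro v
    rw [← generator_comp_shift (hH.differentiable (by norm_num)) (hfb b)]
    rfl
  have i2 (b : Bond d N) : Integrable fun v => bondDeriv o b f (shift d N ρ v) *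
      generator o H (bondDeriv o b f) (shift d N ρ v) * w v := by
    simp_rw [hgen]
    have hcL := (contDiff_driftLaplacian (n := 0) (v := bondTangent o) (hH'.of_le (by norm_num))
      (contDiff_comp_shift ((hfb b).of_le (by norm_num)) ρ)).continuous
    exact integrable_mul_weight hH'.continuous (((hfb b).continuous.comp hs).mul hcL)
      (hasCompactSupport_comp_shift (hcb b) ρ).mul_right
  have i3 (b c : Bond d N) : Integrable fun v => bondDeriv o b f (shift d N ρ v) *
      (bondDeriv o b (bondDeriv o c H) (shift d N ρ v) * bondDeriv o c f (shift d N ρ v)) * w v :=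
    hint ((hfb b).continuous.mul ((hHb b c).mul (hfb c).continuous)) (hcb b).mul_right
  -- The diagonal part of the Witten form is the sum over `b` of the Dirichlet energies of `∂_b f`,
  -- and is discarded.
  have n2 (b : Bond d N) : 0 ≤ ∫ v, bondDeriv o b f (shift d N ρ v) *
      generator o H (bondDeriv o b f) (shift d N ρ v) * w v := by
    simp_rw [hgen]
    rw [integral_mul_driftLaplacian volume (hH'.of_le (by norm_num))
      (contDiff_comp_shift (hfb b) ρ) (contDiff_comp_shift ((hfb b).of_le (by norm_num)) ρ)
      (hasCompactSupport_comp_shift (hcb b) ρ)]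
    exact Finset.sum_nonneg fun c _ => integral_nonneg fun v =>
      mul_nonneg (mul_self_nonneg _) (Real.exp_pos _).le
  have i2' : Integrable fun v => ∑ b, bondDeriv o b f (shift d N ρ v) *
      generator o H (bondDeriv o b f) (shift d N ρ v) * w v :=
    integrable_finsetSum _ fun b _ => i2 b
  have i3' : Integrable fun v => ∑ b, ∑ c, bondDeriv o b f (shift d N ρ v) *
      (bondDeriv o b (bondDeriv o c H) (shift d N ρ v) * bondDeriv o c f (shift d N ρ v)) * w v :=
    integrable_finsetSum _ fun b _ => integrable_finsetSum _ fun c _ => i3 b c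
  have e1 : expect H ρ (fun η => bondGrad o f η ⬝ᵥ bondGrad o f η) =
      invPartition H ρ * ∫ v, (∑ b, bondDeriv o b f (shift d N ρ v) ^ 2) * w v := by
    rw [expect_eq hH.continuous]
    simp only [dotProduct, bondGrad, sq, hw]
  have e2 : expect H ρ (fun η => bondGrad o f η ⬝ᵥ wittenLaplacian o H (bondGrad o f) η) =
      invPartition H ρ * ((∑ b, ∫ v, bondDeriv o b f (shift d N ρ v) *
        generator o H (bondDeriv o b f) (shift d N ρ v) * w v) +
      ∫ v, ∑ b, ∑ c, bondDeriv o b f (shift d N ρ v) *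
      (bondDeriv o b (bondDeriv o c H) (shift d N ρ v) * bondDeriv o c f (shift d N ρ v)) * w v) := by
    rw [expect_eq hH.continuous, ← integral_finsetSum _ fun b _ => i2 b, ← integral_add i2' i3']
    congr 1
    refine integral_congr_ae (ae_of_all _ fun v => ?_)
    simp only [bondGrad_dotProduct_wittenLaplacian, add_mul, Finset.sum_mul, hw]
  rw [e1] at hne
  have hpos : 0 < invPartition H ρ :=
    lt_of_le_of_ne invPartition_nonneg (Ne.symm (left_ne_zero_of_mul hne))
  have hS : 0 < ∫ v, (∑ b, bondDeriv o b f (shift d N ρ v) ^ 2) * w v :=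
    lt_of_le_of_ne (integral_nonneg fun v => by positivity) (Ne.symm (right_ne_zero_of_mul hne))
  rw [e1, e2, mul_div_mul_left _ _ hpos.ne', le_div_iff₀ hS, ← integral_const_mul]
  refine le_add_of_nonneg_of_le (Finset.sum_nonneg fun b _ => n2 b)
    (integral_mono (i1.const_mul _) i3' fun v => ?_)
  have h := mul_le_mul_of_nonneg_right
    (hessian_lower_bound (o := o) h₁ h₂ hC hV₁ hV₂ f (shift d N ρ v)) (Real.exp_pos
      (-((H ∘ shift d N ρ) v))).le
  simp only [Finset.sum_mul, mul_assoc] at h ⊢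
  exact h

end Gaps

end GinzburgLandau

theorem mainTheorem5 :
    ∃ k : ℝ, 0 < k ∧
      ∀ (d : ℕ) (_ : 1 ≤ d) (V₁ V₂ : ℝ → ℝ) (C : ℝ)
        (_ : ContDiff ℝ 2 V₁) (_ : ContDiff ℝ 2 V₂) (_ : 0 < C)
        (_ : ∀ t : ℝ, C ≤ deriv (deriv V₁) t) (_ : ConvexOn ℝ Set.univ V₂)
        (N : ℕ) [NeZero N] (o : GinzburgLandau.Orientation d N) (ρ : ℝ),
        GinzburgLandau.wittenGap o (GinzburgLandau.hamiltonian V₁ V₂) ρ ≤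
            GinzburgLandau.spectralGap o (GinzburgLandau.hamiltonian V₁ V₂) ρ ∧
          ((k * C / (N : ℝ) ^ 2 : ℝ) : EReal) ≤
            GinzburgLandau.wittenGap o (GinzburgLandau.hamiltonian V₁ V₂) ρ := by
  -- The value `k = 1` is inherited from the factor `N²` in the Poincaré inequality on a cycle.
  refine ⟨1, one_pos, fun d _ V₁ V₂ C h₁ h₂ hC hV₁ hV₂ N _ o ρ =>
    ⟨GinzburgLandau.wittenGap_le_spectralGap (GinzburgLandau.contDiff_hamiltonian h₁ h₂), ?_⟩⟩
  rw [one_mul]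
  exact GinzburgLandau.le_wittenGap h₁ h₂ hC.le hV₁ hV₂
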